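/- **Backgrounds.** A (real, even) algebraic background is a tuple $\mathcal B=(\mathcal A,\mathcal K,\pi,\chi,J,\Omega^1)$: a unital real $*$-algebra $\mathcal A$ (a complex one being regarded as real); a complex space $\mathcal K$ with a Krein product, i.e. a Hermitian form $(\cdot,\cdot)$ admitting a fundamental symmetry (an infinite-dimensional Krein space is presented by a common invariant core on which all operators are defined); a representation $\pi$ by even operators with $\pi(a^*)=\pi(a)^\times$, where $\times$ is the Krein adjoint; a chirality $\chi$ with $\chi^2=1$, $\chi^\times=\pm\chi$; an antilinear bijection $J$ with $J^2=\pm1$, $J\chi=\pm\chi J$, $(J\psi,J\varphi)=\pm(\varphi,\psi)$; and an $\mathcal A$-bimodule $\Omega^1\subset\mathrm{End}(\mathcal K)$ of odd, adjointable operators (the 1-forms). With $T^o:=JT^\times J^{-1}$, one requires $[\pi(a)^o,\pi(b)]=0$ for all $a,b\in\mathcal A$. A *compatible Dirac operator* is an operator $D$ with $D^\times=D$, $D\chi=-\chi D$, $DJ=JD$ and $\Omega^1_D:=\{\sum_i\pi(a_i)[D,\pi(b_i)]\}\subset\Omega^1$; it is *regular* if $\Omega^1_D=\Omega^1$. An *automorphism*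 is a Krein-unitary $U$ commuting with $J$ and $\chi$ such that $U\pi(\mathcal A)U^{-1}=\pi(\mathcal A)$ and $U\Omega^1U^{-1}=\Omega^1$. For a unitary $u\in\mathcal A$ put $\Upsilon(u)=\pi(u)(\pi(u)^{-1})^o$, and call the operators $D+\omega+\omega^o$, with $\omega=\omega^\times\in\Omega^1$, the *fluctuated Dirac operators* of $(\mathcal B,D)$. Then * $\mathcal B$ satisfies **weak C1** if $\Upsilon(u)$ is an automorphism of $\mathcal B$ for every unitary $u\in\mathcal A$; * $(\mathcal B,D)$ satisfies **weak C1$'$** if every fluctuated Dirac operator is a compatible Dirac operator for $\mathcal B$; * $(\mathcal B,D)$ satisfies **weak C1$''$** if the set of fluctuated Dirac operators is stable under $D'\mapsto\Upsilon(u)D'\Upsilon(u)^{-1}$ for every unitary $u\in\mathcal A$. **The canonical background.** Let $M$ be a nonempty smooth manifold of even dimension $n$ with a semi-Riemannian metric $g$ (any signature) and a spin structure, i.e. a complex spinor bundle $S$ of rank $2^{n/2}$ with Clifford action $c$, $c(\alpha)^2=-g(\alpha,\alpha)$, spinor metric $H$ for which $c(\alpha)$ is skew, chirality $\chi_M$ anticommuting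 with $c(\alpha)$, and charge conjugation $J_M$ commuting with $c(\alpha)$ (for real covectors $\alpha$), $\chi_M$ and $J_M$ satisfying the sign relations above with respect to each other and to $H$. The canonical background $\mathcal B_M$ has $\mathcal A_M=C^\infty(M,\mathbb R)$ acting by multiplication on the smooth compactly supported sections of $S$, with Krein product $\int_M H(\psi,\varphi)\,\mathrm{vol}_g$, chirality $\chi_M$, real structure $J_M$ and $\Omega^1_M=\{c(\alpha):\alpha\text{ a smooth real 1-form}\}$. **Proposition.** Let $\mathcal B=\mathcal B_M\hat\otimes\mathcal B_F$ be an almost-commutative background, where $\mathcal B_F$ is a background with $\mathcal A_F$ and $\mathcal K_F$ finite-dimensional. Here $\hat\otimes$ is the graded tensor product: $\mathcal A=\mathcal A_M\otimes_{\mathbb R}\mathcal A_F$ acts on $\mathcal K=\mathcal K_M\otimes_{\mathbb C}\mathcal K_F$ by $\pi_M\otimes\pi_F$, $\chi=\chi_M\otimes\chi_F$, $\Omega^1=\Omega^1_M\hat\otimes\mathcal A_F+\mathcal A_M\hat\otimes\Omega^1_F$ where $\omega\hat\otimes a$ acts as $\omega\otimes\pi_F(a)$ and $f\hat\otimes\theta$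 as $f\chi_M\otimes\theta$; $J=J_M\otimes J_F\chi_F^{j}$ and $(\psi\otimes\varphi,\psi'\otimes\varphi')=i^{pq}(\psi,\psi')(\varphi,\chi_F^{p}\varphi')$, where $j,p,q\in\{0,1\}$ are given by $J_M\chi_M=(-1)^j\chi_MJ_M$, $\chi_M^\times=(-1)^p\chi_M$, $\chi_F^\times=(-1)^q\chi_F$. Let $D_M$ and $D_F$ be regular Dirac operators for $\mathcal B_M$ and $\mathcal B_F$, and let $D=D_M\hat\otimes1+1\hat\otimes D_F=D_M\otimes1+\chi_M\otimes D_F$. Then $(\mathcal B,D)$ satisfies weak C1, C1$'$ and C1$''$ if and only if $(\mathcal B_F,D_F)$ does. -/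

import Mathlib

open scoped TensorProduct ComplexConjugate

noncomputable section

/-- A Krein product on a complex vector space `K`: a Hermitian form (conjugate-linear in the first
variable) which admits a fundamental symmetry `η`, that is a form-symmetric involution for which
`(x, η y)` is a positive definite inner product.  On a finite-dimensional `K` this is exactly the
structure of a Krein space; in general it presents the Krein space through a dense subspace
on which all the operators in play are defined. -/
structure KreinProduct (K : Type*) [AddCommGroup K] [Module ℂ K] where
  form : K →ₗ⋆[ℂ] K →ₗ[ℂ] ℂ
  conj_symm : ∀ x y, conj (form x y) = form y x
  exists_fundamentalSymmetry : ∃ η : Module.End ℂ K,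
    (∀ x, η (η x) = x) ∧ (∀ x y, form (η x) y = form x (η y)) ∧
      ∀ x, x ≠ 0 → 0 < (form x (η x)).re

namespace KreinProduct

variable {K : Type*} [AddCommGroup K] [Module ℂ K] (κ : KreinProduct K)

/-- `S` is a Krein adjoint of `T`. -/
def IsAdjoint (T S : Module.End ℂ K) : Prop := ∀ x y, κ.form (T x) y = κ.form x (S y)

/-- The Krein adjoint `T^×` (it is unique, and it is set to `0` if there is none). -/
def adj (T : Module.End ℂ K) : Module.End ℂ K :=
  open Classical in if h : ∃ S, κ.IsAdjoint T S then h.choose else 0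

/-- Self-adjointness for the Krein product. -/
def IsSelfAdj (T : Module.End ℂ K) : Prop := κ.IsAdjoint T T

/-- The opposite `T^o = J T^× J⁻¹`. -/
def opp (J : K ≃ₛₗ[starRingEnd ℂ] K) (T : Module.End ℂ K) : Module.End ℂ K :=
  (J.toLinearMap ∘ₛₗ κ.adj T) ∘ₛₗ J.symm.toLinearMap

theorem eq_zero_of_form {y : K} (h : ∀ x, κ.form x y = 0) : y = 0 := by
  obtain ⟨η, -, h2, h3⟩ := κ.exists_fundamentalSymmetry
  by_contra hy
  have := h3 y hy
  rw [← h2, h] at this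
  simp at this

theorem adj_eq {T S : Module.End ℂ K} (h : κ.IsAdjoint T S) : κ.adj T = S := by
  have hex : ∃ S, κ.IsAdjoint T S := ⟨S, h⟩
  have : κ.adj T = hex.choose := by simp only [adj, dif_pos hex]
  rw [this]
  ext y
  rw [← sub_eq_zero]
  apply κ.eq_zero_of_form
  intro x
  rw [map_sub, ← hex.choose_spec x y, ← h x y, sub_self]

theorem opp_apply_of {T S : Module.End ℂ K} (h : κ.IsAdjoint T S)
    (J : K ≃ₛₗ[starRingEnd ℂ] K) (x : K) : κ.opp J T x = J (S (J.symm x)) := by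
  simp [opp, κ.adj_eq h]

end KreinProduct

/-- The sign attached to a parity: `true` stands for odd. -/
def paritySign (b : Bool) : ℂ := if b then -1 else 1

/-- A real even algebraic background `(A, K, π, χ, J, Ω¹)`, for a real `*`-algebra `A` (a complex
`*`-algebra is one by restriction of scalars) and a space `K` with a Krein product.  As usual for
real even spectral triples in arbitrary signature, `J² = ±1`, `J` preserves the Krein product up to sign (and conjugation),
and `χ` commutes or anticommutes with `J` and is self-adjoint or anti-self-adjoint;
the last two signs are recorded as parities. -/
structure AlgebraicBackground (A K : Type*) [Ring A] [StarRing A] [Algebra ℝ A]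
    [AddCommGroup K] [Module ℂ K] extends KreinProduct K where
  /-- the representation -/
  rep : A →+* Module.End ℂ K
  /-- the chirality -/
  χ : Module.End ℂ K
  /-- the real structure -/
  J : K ≃ₛₗ[starRingEnd ℂ] K
  /-- the bimodule of 1-forms -/
  Ω : AddSubgroup (Module.End ℂ K)
  /-- whether `χ` is anti-self-adjoint -/
  formOdd : Bool
  /-- whether `J` anticommutes with `χ` -/
  JOdd : Bool
  rep_smul : ∀ (r : ℝ) (a : A), rep (r • a) = (r : ℂ) • rep a
  rep_star : ∀ a, toKreinProduct.IsAdjoint (rep a) (rep (star a))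
  χ_sq : ∀ x, χ (χ x) = x
  χ_form : ∀ x y, form (χ x) y = paritySign formOdd * form x (χ y)
  χ_rep : ∀ a x, χ (rep a x) = rep a (χ x)
  J_sq : (∀ x, J (J x) = x) ∨ (∀ x, J (J x) = -x)
  J_χ : ∀ x, J (χ x) = paritySign JOdd • χ (J x)
  J_form : (∀ x y, form (J x) (J y) = form y x) ∨ (∀ x y, form (J x) (J y) = -form y x)
  Ω_odd : ∀ ω ∈ Ω, ∀ x, χ (ω x) = -ω (χ x)
  Ω_left : ∀ a, ∀ ω ∈ Ω, rep a * ω ∈ Ω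
  Ω_right : ∀ a, ∀ ω ∈ Ω, ω * rep a ∈ Ω
  Ω_adj : ∀ ω ∈ Ω, ∃ S, toKreinProduct.IsAdjoint ω S
  /-- the order zero condition -/
  order_zero : ∀ a b, Commute (toKreinProduct.opp J (rep a)) (rep b)

namespace AlgebraicBackground

variable {A K : Type*} [Ring A] [StarRing A] [Algebra ℝ A]
  [AddCommGroup K] [Module ℂ K] (B : AlgebraicBackground A K)

/-- The opposite of an operator. -/
def op (T : Module.End ℂ K) : Module.End ℂ K := B.opp B.J T

theorem op_rep_apply (a : A) (x : K) : B.op (B.rep a) x = B.J (B.rep (star a) (B.J.symm x)) :=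
  B.opp_apply_of (B.rep_star a) B.J x

theorem op_rep_mul (a b : A) : B.op (B.rep a) * B.op (B.rep b) = B.op (B.rep (b * a)) := by
  ext x
  rw [Module.End.mul_apply, op_rep_apply, op_rep_apply, op_rep_apply, star_mul, map_mul]
  simp

theorem op_rep_one : B.op (B.rep 1) = 1 := by
  ext x
  rw [op_rep_apply, star_one, map_one]
  simp

/-- `D` is a Dirac operator for the data of `B`: self-adjoint, odd, and commuting with `J`. -/
structure IsDirac (D : Module.End ℂ K) : Prop where
  selfAdj : B.IsSelfAdj D
  odd : ∀ x, D (B.χ x) = -B.χ (D x)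
  real : ∀ x, D (B.J x) = B.J (D x)

/-- `Ω¹_D`, the bimodule of the sums `∑ π(aᵢ) [D, π(bᵢ)]`. -/
def oneForms (D : Module.End ℂ K) : AddSubgroup (Module.End ℂ K) :=
  AddSubgroup.closure {T | ∃ a b : A, T = B.rep a * (D * B.rep b - B.rep b * D)}

/-- Compatible Dirac operators. -/
def IsCompatible (D : Module.End ℂ K) : Prop := B.IsDirac D ∧ B.oneForms D ≤ B.Ω

/-- Regular Dirac operators. -/
def IsRegular (D : Module.End ℂ K) : Prop := B.IsDirac D ∧ B.oneForms D = B.Ω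

/-- The configuration space: all compatible Dirac operators. -/
def configurationSpace : Set (Module.End ℂ K) := {D | B.IsCompatible D}

/-- Automorphisms of a background. -/
structure IsAutomorphism (U : (Module.End ℂ K)ˣ) : Prop where
  unitary : ∀ x y, B.form (U.val x) (U.val y) = B.form x y
  map_algebra : (fun T => U.val * T * U⁻¹.val) '' Set.range B.rep = Set.range B.rep
  map_forms : (fun T => U.val * T * U⁻¹.val) '' (B.Ω : Set (Module.End ℂ K)) = B.Ω
  comm_J : ∀ x, U.val (B.J x) = B.J (U.val x)
  comm_χ : ∀ x, U.val (B.χ x) = B.χ (U.val x)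

/-- The gauge transformation `Υ(u) = π(u) (π(u)⁻¹)^o` of a unitary element `u`. -/
def gauge (u : unitary A) : (Module.End ℂ K)ˣ where
  val := B.rep u * B.op (B.rep (star u : A))
  inv := B.op (B.rep u) * B.rep (star u : A)
  val_inv := by
    have h : B.op (B.rep (star u : A)) * B.op (B.rep u) = 1 := by
      rw [op_rep_mul]; simp [-map_one, op_rep_one]
    have h' : B.rep (u : A) * B.rep (star u : A) = 1 := by rw [← map_mul]; simp
    calc _ = B.rep u * (B.op (B.rep (star u : A)) * B.op (B.rep u)) * B.rep (star u : A) := by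
          simp only [mul_assoc]
      _ = 1 := by rw [h, mul_one, h']
  inv_val := by
    have h : B.op (B.rep u) * B.op (B.rep (star u : A)) = 1 := by
      rw [op_rep_mul]; simp [-map_one, op_rep_one]
    have h' : B.rep (star u : A) * B.rep (u : A) = 1 := by rw [← map_mul]; simp
    calc _ = B.op (B.rep u) * (B.rep (star u : A) * B.rep u) * B.op (B.rep (star u : A)) := by
          simp only [mul_assoc]
      _ = 1 := by rw [h', mul_one, h]

/-- The fluctuated Dirac operators `D + ω + ω^o`, with `ω` a self-adjoint 1-form. -/
def fluctuatedDiracs (D : Module.End ℂ K) : Set (Module.End ℂ K) :=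
  {D' | ∃ ω ∈ B.Ω, B.IsSelfAdj ω ∧ D' = D + ω + B.op ω}

/-- Weak C1: gauge transformations are symmetries of the background. -/
def WeakC1 : Prop := ∀ u : unitary A, B.IsAutomorphism (B.gauge u)

/-- Weak C1': the fluctuated Dirac operators belong to the configuration space. -/
def WeakC1' (D : Module.End ℂ K) : Prop := B.fluctuatedDiracs D ⊆ B.configurationSpace

/-- Weak C1'': the set of fluctuated Dirac operators is stable under gauge transformations. -/
def WeakC1'' (D : Module.End ℂ K) : Prop := ∀ u : unitary A, ∀ D' ∈ B.fluctuatedDiracs D,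
  (B.gauge u).val * D' * (B.gauge u)⁻¹.val ∈ B.fluctuatedDiracs D

end AlgebraicBackground

section FiniteDimensional

/-- A nondegenerate Hermitian form on a finite-dimensional space can be diagonalized. -/
theorem exists_diagonal_basis {K : Type*} [AddCommGroup K] [Module ℂ K] [FiniteDimensional ℂ K]
    (f : K →ₗ⋆[ℂ] K →ₗ[ℂ] ℂ) (hf : ∀ x y, conj (f x y) = f y x)
    (hn : ∀ y, (∀ x, f x y = 0) → y = 0) :
    ∃ (v : Module.Basis (Fin (Module.finrank ℂ K)) ℂ K) (l : Fin (Module.finrank ℂ K) → ℝ),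
      (∀ i, l i ≠ 0) ∧ ∀ i j, f (v i) (v j) = if i = j then (l i : ℂ) else 0 := by
  classical
  set m := Module.finrank ℂ K with hm
  let E := EuclideanSpace ℂ (Fin m)
  let e : E ≃ₗ[ℂ] K := LinearEquiv.ofFinrankEq _ _ (by simp [E, hm])
  let b := EuclideanSpace.basisFun (Fin m) ℂ
  let T : E →ₗ[ℂ] E := ∑ i, ((f (e (b i))).comp e.toLinearMap).smulRight (b i)
  have hT : ∀ x y, inner ℂ x (T y) = f (e x) (e y) := by
    intro x y
    have hTy : T y = ∑ i, f (e (b i)) (e y) • b i := by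
      simp [T, LinearMap.sum_apply]
    have hx : f (e x) (e y) = f (e (∑ i, inner ℂ (b i) x • b i)) (e y) := by
      rw [b.sum_repr']
    rw [hx, hTy, inner_sum]
    simp only [LinearMap.sum_apply, map_sum, inner_smul_right, map_smul, map_smulₛₗ,
      LinearMap.smul_apply, smul_eq_mul]
    refine Finset.sum_congr rfl fun i _ => ?_
    rw [inner_conj_symm, mul_comm]
  have hs : T.IsSymmetric := by
    intro x y
    rw [← inner_conj_symm, hT, hT, hf]
  have hE : Module.finrank ℂ E = m := by simp [E]
  let w := hs.eigenvectorBasis hE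
  refine ⟨w.toBasis.map e, hs.eigenvalues hE, ?_, ?_⟩
  · intro i hi
    have h0 : T (w i) = 0 := by
      rw [hs.apply_eigenvectorBasis hE i, hi]; simp
    have : e (w i) = 0 := by
      apply hn
      intro x
      obtain ⟨x, rfl⟩ := e.surjective x
      rw [← hT, h0, inner_zero_right]
    have h1 : w i = 0 := by simpa using this
    have := w.norm_eq_one i
    rw [h1] at this
    simp at this
  · intro i j
    simp only [Module.Basis.map_apply, OrthonormalBasis.coe_toBasis]
    rw [← hT, hs.apply_eigenvectorBasis hE j, inner_smul_right, OrthonormalBasis.inner_eq_ite]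
    split_ifs with h
    · subst h; simp
    · simp

end FiniteDimensional

namespace AlgebraicBackground

variable {A₁ K₁ A₂ K₂ : Type*} [Ring A₁] [StarRing A₁] [Algebra ℝ A₁]
  [AddCommGroup K₁] [Module ℂ K₁] [Ring A₂] [StarRing A₂] [Algebra ℝ A₂]
  [AddCommGroup K₂] [Module ℂ K₂]
  (B₁ : AlgebraicBackground A₁ K₁) (B₂ : AlgebraicBackground A₂ K₂)

/-- `χ^p` for a parity `p`. -/
def χpow {A K : Type*} [Ring A] [StarRing A] [Algebra ℝ A] [AddCommGroup K] [Module ℂ K]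
    (B : AlgebraicBackground A K) (p : Bool) : Module.End ℂ K := if p then B.χ else 1

/-- The form `i^{pq} (φ, χ^p φ')` on the second factor of a graded tensor product, where `p`, `q`
are the parities of the two Krein products. -/
def twistedForm (p : Bool) : K₂ →ₗ⋆[ℂ] K₂ →ₗ[ℂ] ℂ :=
  (if p && B₂.formOdd then Complex.I else 1) • (B₂.form.compl₂ (B₂.χpow p))

theorem twistedForm_apply (p : Bool) (x y : K₂) : B₂.twistedForm p x y =
    (if p && B₂.formOdd then Complex.I else 1) * B₂.form x (B₂.χpow p y) := rfl

theorem χ_form' (x y : K₂) :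
    B₂.form x (B₂.χ y) = paritySign B₂.formOdd * B₂.form (B₂.χ x) y := by
  rw [B₂.χ_form, ← mul_assoc]
  cases B₂.formOdd <;> simp [paritySign]

theorem twistedForm_conj (p : Bool) (x y : K₂) :
    conj (B₂.twistedForm p x y) = B₂.twistedForm p y x := by
  simp only [twistedForm_apply, map_mul, B₂.conj_symm]
  cases p
  · simp [χpow]
  · simp only [χpow, if_true, B₂.χ_form]
    cases B₂.formOdd <;> simp [paritySign]

theorem twistedForm_nondeg (p : Bool) (y : K₂) (h : ∀ x, B₂.twistedForm p x y = 0) : y = 0 := by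
  have h1 : B₂.χpow p y = 0 := by
    apply B₂.eq_zero_of_form
    intro x
    have := h x
    rw [twistedForm_apply, mul_eq_zero] at this
    refine this.resolve_left ?_
    split_ifs <;> simp
  cases p
  · simpa [χpow] using h1
  · have h2 := congrArg B₂.χ h1
    simpa [χpow, B₂.χ_sq] using h2

/-- The Krein product of a graded tensor product (with a finite-dimensional second factor):
`(ψ ⊗ φ, ψ' ⊗ φ') = i^{pq} (ψ, ψ') (φ, χ^p φ')`, with `p`, `q` the parities of the two Krein
products.  This is the product for which `D₁ ⊗ 1 + χ₁ ⊗ D₂` is self-adjoint. -/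
def tensorForm : K₁ ⊗[ℂ] K₂ →ₗ⋆[ℂ] K₁ ⊗[ℂ] K₂ →ₗ[ℂ] ℂ :=
  ((TensorProduct.lift <| TensorProduct.mapBilinear (.id ℂ) K₁ K₂ ℂ ℂ).compr₂ (.mul' ℂ ℂ)) ∘ₛₗ
    TensorProduct.map B₁.form (B₂.twistedForm B₁.formOdd)

theorem tensorForm_tmul (x x' : K₁) (y y' : K₂) :
    tensorForm B₁ B₂ (x ⊗ₜ y) (x' ⊗ₜ y') =
      B₁.form x x' * B₂.twistedForm B₁.formOdd y y' := rfl

/-- Two additive statements about a pair of tensors agree if they do on pure tensors. -/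
theorem tensor_ind₂ {P : K₁ ⊗[ℂ] K₂ → K₁ ⊗[ℂ] K₂ → Prop}
    (h0 : ∀ z, P 0 z) (h0' : ∀ z, P z 0)
    (ht : ∀ x y x' y', P (x ⊗ₜ y) (x' ⊗ₜ y'))
    (ha : ∀ z z' w, P z w → P z' w → P (z + z') w)
    (ha' : ∀ z w w', P z w → P z w' → P z (w + w')) (z w) : P z w := by
  induction z with
  | zero => exact h0 w
  | add z z' h h' => exact ha _ _ _ h h'
  | tmul x y =>
    induction w with
    | zero => exact h0' _
    | add w w' h h' => exact ha' _ _ _ h h'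
    | tmul x' y' => exact ht _ _ _ _

theorem tensorForm_conj (z w : K₁ ⊗[ℂ] K₂) :
    conj (tensorForm B₁ B₂ z w) = tensorForm B₁ B₂ w z := by
  refine tensor_ind₂ (P := fun z w => conj (tensorForm B₁ B₂ z w) = tensorForm B₁ B₂ w z)
    ?_ ?_ ?_ ?_ ?_ z w
  · simp
  · simp
  · intro x y x' y'
    rw [tensorForm_tmul, tensorForm_tmul, map_mul, B₁.conj_symm, twistedForm_conj]
  · intro z z' w h h'
    simp [h, h']
  · intro z w w' h h'
    simp [h, h']

theorem tensor_exists_fundamental [FiniteDimensional ℂ K₂] :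
    ∃ η : Module.End ℂ (K₁ ⊗[ℂ] K₂), (∀ x, η (η x) = x) ∧
      (∀ x y, tensorForm B₁ B₂ (η x) y = tensorForm B₁ B₂ x (η y)) ∧
      ∀ x, x ≠ 0 → 0 < (tensorForm B₁ B₂ x (η x)).re := by
  classical
  obtain ⟨η₁, h1, h2, h3⟩ := B₁.exists_fundamentalSymmetry
  obtain ⟨v, l, hl, hv⟩ := exists_diagonal_basis (B₂.twistedForm B₁.formOdd)
    (B₂.twistedForm_conj _) (B₂.twistedForm_nondeg _)
  let η₂ : Module.End ℂ K₂ := v.constr ℂ fun i => ((SignType.sign (l i) : ℝ) : ℂ) • v i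
  have hη₂ : ∀ i, η₂ (v i) = ((SignType.sign (l i) : ℝ) : ℂ) • v i := fun i => by
    simp only [η₂, Module.Basis.constr_basis]
  have hss : ∀ i, ((SignType.sign (l i) : ℝ) : ℂ) * ((SignType.sign (l i) : ℝ) : ℂ) = 1 := by
    intro i
    rcases lt_or_gt_of_ne (hl i) with h | h <;> simp [h]
  have hdec : ∀ z : K₁ ⊗[ℂ] K₂, ∃ c : Fin (Module.finrank ℂ K₂) → K₁, z = ∑ i, c i ⊗ₜ[ℂ] v i := by
    intro z
    induction z with
    | zero => exact ⟨0, by simp⟩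
    | add z z' h h' =>
      obtain ⟨c, rfl⟩ := h
      obtain ⟨c', rfl⟩ := h'
      exact ⟨c + c', by simp [TensorProduct.add_tmul, Finset.sum_add_distrib]⟩
    | tmul x y =>
      refine ⟨fun i => v.repr y i • x, ?_⟩
      conv_lhs => rw [← v.sum_repr y, TensorProduct.tmul_sum]
      exact Finset.sum_congr rfl fun i _ => (TensorProduct.smul_tmul _ _ _).symm
  have hηc : ∀ c : Fin (Module.finrank ℂ K₂) → K₁, TensorProduct.map η₁ η₂ (∑ i, c i ⊗ₜ[ℂ] v i) =
      ∑ i, (((SignType.sign (l i) : ℝ) : ℂ) • η₁ (c i)) ⊗ₜ[ℂ] v i := by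
    intro c
    simp [map_sum, hη₂, TensorProduct.smul_tmul]
  have hform : ∀ c c' : Fin (Module.finrank ℂ K₂) → K₁,
      tensorForm B₁ B₂ (∑ i, c i ⊗ₜ[ℂ] v i) (∑ i, c' i ⊗ₜ[ℂ] v i) =
        ∑ i, B₁.form (c i) (c' i) * (l i : ℂ) := by
    intro c c'
    simp only [map_sum, LinearMap.sum_apply, tensorForm_tmul, hv]
    simp
  have hsc : ∀ i, conj ((SignType.sign (l i) : ℝ) : ℂ) = ((SignType.sign (l i) : ℝ) : ℂ) :=
    fun i => Complex.conj_ofReal _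
  refine ⟨TensorProduct.map η₁ η₂, ?_, ?_, ?_⟩
  · intro z
    obtain ⟨c, rfl⟩ := hdec z
    rw [hηc, hηc]
    refine Finset.sum_congr rfl fun i _ => ?_
    rw [map_smul, smul_smul, hss, one_smul, h1]
  · intro z w
    obtain ⟨c, rfl⟩ := hdec z
    obtain ⟨c', rfl⟩ := hdec w
    rw [hηc, hηc, hform, hform]
    refine Finset.sum_congr rfl fun i _ => ?_
    rw [map_smulₛₗ, map_smul, LinearMap.smul_apply, hsc, h2]
  · intro z hz
    obtain ⟨c, rfl⟩ := hdec z
    rw [hηc, hform, Complex.re_sum]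
    have hterm : ∀ i, (B₁.form (c i) (((SignType.sign (l i) : ℝ) : ℂ) • η₁ (c i)) * (l i : ℂ)).re =
        (B₁.form (c i) (η₁ (c i))).re * |l i| := by
      intro i
      rw [map_smul, smul_eq_mul, mul_comm _ (B₁.form _ _), mul_assoc, ← Complex.ofReal_mul,
        Complex.re_mul_ofReal, sign_mul_self]
    simp only [hterm]
    have hnn : ∀ i, 0 ≤ (B₁.form (c i) (η₁ (c i))).re * |l i| := by
      intro i
      by_cases hc : c i = 0
      · simp [hc]
      · exact mul_nonneg (h3 _ hc).le (abs_nonneg _)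
    obtain ⟨i, hi⟩ : ∃ i, c i ≠ 0 := by
      by_contra hcon
      push Not at hcon
      exact hz (by simp [hcon])
    exact Finset.sum_pos' (fun i _ => hnn i)
      ⟨i, Finset.mem_univ i, mul_pos (h3 _ hi) (abs_pos.mpr (hl i))⟩

/-- The Krein product of the graded tensor product. -/
def tensorKrein [FiniteDimensional ℂ K₂] : KreinProduct (K₁ ⊗[ℂ] K₂) where
  form := tensorForm B₁ B₂
  conj_symm := tensorForm_conj B₁ B₂
  exists_fundamentalSymmetry := tensor_exists_fundamental B₁ B₂

end AlgebraicBackground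

namespace AlgebraicBackground

variable {A₁ K₁ A₂ K₂ : Type*} [Ring A₁] [StarRing A₁] [Algebra ℝ A₁]
  [AddCommGroup K₁] [Module ℂ K₁] [Ring A₂] [StarRing A₂] [Algebra ℝ A₂]
  [AddCommGroup K₂] [Module ℂ K₂]
  (B₁ : AlgebraicBackground A₁ K₁) (B₂ : AlgebraicBackground A₂ K₂)

/-- The representation `π₁ ⊗ π₂` (algebra elements are represented by even operators, so that
there is no sign). -/
def tensorRep : A₁ ⊗[ℝ] A₂ →+* Module.End ℂ (K₁ ⊗[ℂ] K₂) :=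
  letI : Module ℝ (K₁ ⊗[ℂ] K₂) := Module.complexToReal _
  (Algebra.TensorProduct.lift (R := ℝ) (S := ℝ) (C := Module.End ℂ (K₁ ⊗[ℂ] K₂))
    (AlgHom.mk' ((Module.End.rTensorAlgHom ℂ K₁ K₂).toRingHom.comp B₁.rep) (by
      intro r a; simp only [RingHom.comp_apply, B₁.rep_smul]; exact map_smul (Module.End.rTensorAlgHom ℂ K₁ K₂) _ _))
    (AlgHom.mk' ((Module.End.lTensorAlgHom ℂ K₂ K₁).toRingHom.comp B₂.rep) (by
      intro r a; simp only [RingHom.comp_apply, B₂.rep_smul]; exact map_smul (Module.End.lTensorAlgHom ℂ K₂ K₁) _ _))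
    (fun a b => by
      apply LinearMap.ext fun z => ?_
      induction z with
      | zero => simp
      | add z w hz hw => rw [map_add, hz, hw, map_add]
      | tmul x y => rfl)).toRingHom

theorem tensorRep_tmul (a : A₁) (b : A₂) :
    tensorRep B₁ B₂ (a ⊗ₜ b) = TensorProduct.map (B₁.rep a) (B₂.rep b) := by
  refine (Algebra.TensorProduct.lift_tmul _ _ _ _ _).trans ?_
  apply LinearMap.ext fun z => ?_
  induction z with
  | zero => simp
  | add z w hz hw => rw [map_add, hz, hw, map_add]
  | tmul x y => rfl

theorem tensorRep_smul (r : ℝ) (c : A₁ ⊗[ℝ] A₂) :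
    tensorRep B₁ B₂ (r • c) = (r : ℂ) • tensorRep B₁ B₂ c := by
  induction c with
  | zero => simp
  | add c c' h h' => rw [smul_add, map_add, h, h', map_add, smul_add]
  | tmul a b =>
    rw [TensorProduct.smul_tmul', tensorRep_tmul, tensorRep_tmul, B₁.rep_smul,
      TensorProduct.map_smul_left]

theorem χpow_χpow (p : Bool) (x : K₂) : B₂.χpow p (B₂.χpow p x) = x := by
  cases p <;> simp [χpow, B₂.χ_sq]

/-- `χ^p` as an equivalence. -/
def χequiv (p : Bool) : K₂ ≃ₗ[ℂ] K₂ :=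
  LinearEquiv.ofInvolutive (B₂.χpow p) (B₂.χpow_χpow p)

/-- The real structure `J₁ ⊗ J₂ χ₂^p` of a graded tensor product, `p` being the parity of `J₁`.
This is the choice which commutes with `D₁ ⊗ 1 + χ₁ ⊗ D₂`. -/
def tensorJ : K₁ ⊗[ℂ] K₂ ≃ₛₗ[starRingEnd ℂ] K₁ ⊗[ℂ] K₂ :=
  TensorProduct.congr B₁.J ((B₂.χequiv B₁.JOdd).trans B₂.J)

theorem tensorJ_tmul (x : K₁) (y : K₂) :
    tensorJ B₁ B₂ (x ⊗ₜ y) = B₁.J x ⊗ₜ B₂.J (B₂.χpow B₁.JOdd y) := rfl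

/-- The 1-forms `Ω¹₁ ⊗̂ A₂ + A₁ ⊗̂ Ω¹₂` of a graded tensor product.  An operator `T ⊗̂ θ` with
`θ` odd acts as `T χ₁ ⊗ θ`. -/
def tensorΩ : AddSubgroup (Module.End ℂ (K₁ ⊗[ℂ] K₂)) :=
  AddSubgroup.closure {T | ∃ ω ∈ B₁.Ω, ∃ a : A₂, T = TensorProduct.map ω (B₂.rep a)} ⊔
  AddSubgroup.closure {T | ∃ a : A₁, ∃ θ ∈ B₂.Ω, T = TensorProduct.map (B₁.rep a * B₁.χ) θ}

theorem tensorΩ_induction {P : Module.End ℂ (K₁ ⊗[ℂ] K₂) → Prop}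
    (h1 : ∀ ω ∈ B₁.Ω, ∀ a : A₂, P (TensorProduct.map ω (B₂.rep a)))
    (h2 : ∀ a : A₁, ∀ θ ∈ B₂.Ω, P (TensorProduct.map (B₁.rep a * B₁.χ) θ))
    (h0 : P 0) (ha : ∀ T T', P T → P T' → P (T + T')) (hs : ∀ T, P T → P (-T))
    (T) (hT : T ∈ tensorΩ B₁ B₂) : P T := by
  rw [tensorΩ, ← AddSubgroup.closure_union] at hT
  induction hT using AddSubgroup.closure_induction with
  | mem T hT =>
    rcases hT with ⟨ω, hω, a, rfl⟩ | ⟨a, θ, hθ, rfl⟩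
    · exact h1 ω hω a
    · exact h2 a θ hθ
  | zero => exact h0
  | add T T' _ _ h h' => exact ha _ _ h h'
  | neg T _ h => exact hs _ h

theorem map_mem_tensorΩ_left {ω : Module.End ℂ K₁} (hω : ω ∈ B₁.Ω) (a : A₂) :
    TensorProduct.map ω (B₂.rep a) ∈ tensorΩ B₁ B₂ :=
  (le_sup_left : _ ≤ tensorΩ B₁ B₂) (AddSubgroup.subset_closure ⟨ω, hω, a, rfl⟩)

theorem map_mem_tensorΩ_right (a : A₁) {θ : Module.End ℂ K₂} (hθ : θ ∈ B₂.Ω) :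
    TensorProduct.map (B₁.rep a * B₁.χ) θ ∈ tensorΩ B₁ B₂ :=
  (le_sup_right : _ ≤ tensorΩ B₁ B₂) (AddSubgroup.subset_closure ⟨a, θ, hθ, rfl⟩)

theorem tensorΩ_left (c : A₁ ⊗[ℝ] A₂) (T) (hT : T ∈ tensorΩ B₁ B₂) :
    tensorRep B₁ B₂ c * T ∈ tensorΩ B₁ B₂ := by
  induction c with
  | zero => simp
  | add c c' h h' => rw [map_add, add_mul]; exact add_mem h h'
  | tmul a b =>
    revert T
    refine tensorΩ_induction B₁ B₂ ?_ ?_ (by simp) ?_ ?_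
    · intro ω hω a'
      rw [tensorRep_tmul, ← TensorProduct.map_mul, ← map_mul]
      exact map_mem_tensorΩ_left _ _ (B₁.Ω_left a ω hω) _
    · intro a' θ hθ
      rw [tensorRep_tmul, ← TensorProduct.map_mul, ← mul_assoc, ← map_mul]
      exact map_mem_tensorΩ_right _ _ _ (B₂.Ω_left b θ hθ)
    · intro T T' h h'
      rw [mul_add]; exact add_mem h h'
    · intro T h
      have e : tensorRep B₁ B₂ (a ⊗ₜ b) * -T = -(tensorRep B₁ B₂ (a ⊗ₜ b) * T) :=
        LinearMap.ext fun z => (tensorRep B₁ B₂ (a ⊗ₜ b)).map_neg (T z)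
      rw [e]; exact neg_mem h

theorem χ_mul_rep (a : A₁) : B₁.χ * B₁.rep a = B₁.rep a * B₁.χ := LinearMap.ext (B₁.χ_rep a)

theorem tensorΩ_right (c : A₁ ⊗[ℝ] A₂) (T) (hT : T ∈ tensorΩ B₁ B₂) :
    T * tensorRep B₁ B₂ c ∈ tensorΩ B₁ B₂ := by
  induction c with
  | zero => simp
  | add c c' h h' => rw [map_add, mul_add]; exact add_mem h h'
  | tmul a b =>
    revert T
    refine tensorΩ_induction B₁ B₂ ?_ ?_ (by simp) ?_ ?_
    · intro ω hω a'
      rw [tensorRep_tmul, ← TensorProduct.map_mul, ← map_mul]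
      exact map_mem_tensorΩ_left _ _ (B₁.Ω_right a ω hω) _
    · intro a' θ hθ
      rw [tensorRep_tmul, ← TensorProduct.map_mul, mul_assoc, χ_mul_rep, ← mul_assoc, ← map_mul]
      exact map_mem_tensorΩ_right _ _ _ (B₂.Ω_right b θ hθ)
    · intro T T' h h'
      rw [add_mul]; exact add_mem h h'
    · intro T h
      have e : -T * tensorRep B₁ B₂ (a ⊗ₜ b) = -(T * tensorRep B₁ B₂ (a ⊗ₜ b)) :=
        LinearMap.ext fun z => rfl
      rw [e]; exact neg_mem h

theorem tensor_isAdjoint [FiniteDimensional ℂ K₂] {T S : Module.End ℂ (K₁ ⊗[ℂ] K₂)}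
    (h : ∀ x y x' y', tensorForm B₁ B₂ (T (x ⊗ₜ y)) (x' ⊗ₜ y') =
      tensorForm B₁ B₂ (x ⊗ₜ y) (S (x' ⊗ₜ y'))) : (tensorKrein B₁ B₂).IsAdjoint T S := by
  intro z w
  refine tensor_ind₂ (P := fun z w => tensorForm B₁ B₂ (T z) w = tensorForm B₁ B₂ z (S w))
    ?_ ?_ h ?_ ?_ z w
  · simp
  · simp
  · intro z z' w h h'
    simp [h, h']
  · intro z w w' h h'
    simp [h, h']

/-- Krein adjoint of an even operator `T ⊗ π₂(b)`. -/
theorem map_isAdjoint_even [FiniteDimensional ℂ K₂] {T S : Module.End ℂ K₁}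
    (h : B₁.IsAdjoint T S) (b : A₂) :
    (tensorKrein B₁ B₂).IsAdjoint (TensorProduct.map T (B₂.rep b))
      (TensorProduct.map S (B₂.rep (star b))) := by
  apply tensor_isAdjoint
  intro x y x' y'
  rw [TensorProduct.map_tmul, TensorProduct.map_tmul, tensorForm_tmul, tensorForm_tmul, h x x',
    twistedForm_apply, twistedForm_apply, B₂.rep_star b]
  cases B₁.formOdd
  · simp [χpow]
  · simp [χpow, B₂.χ_rep]

theorem tensorRep_star [StarModule ℝ A₁] [StarModule ℝ A₂] [FiniteDimensional ℂ K₂]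
    (c : A₁ ⊗[ℝ] A₂) :
    (tensorKrein B₁ B₂).IsAdjoint (tensorRep B₁ B₂ c) (tensorRep B₁ B₂ (star c)) := by
  induction c with
  | zero => intro z w; simp
  | add c c' h h' => intro z w; simp [h z w, h' z w]
  | tmul a b =>
    rw [TensorProduct.star_tmul, tensorRep_tmul, tensorRep_tmul]
    exact map_isAdjoint_even B₁ B₂ (B₁.rep_star a) b

/-- Krein adjoint of an odd operator `π₁(a) ⊗̂ θ`. -/
theorem map_isAdjoint_odd [FiniteDimensional ℂ K₂] {T S : Module.End ℂ K₂}
    (h : B₂.IsAdjoint T S) (hT : ∀ x, B₂.χ (T x) = -T (B₂.χ x)) (a : A₁) :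
    (tensorKrein B₁ B₂).IsAdjoint (TensorProduct.map (B₁.rep a * B₁.χ) T)
      (TensorProduct.map (B₁.rep (star a) * B₁.χ) S) := by
  have hS : ∀ y y', B₂.form y (S (B₂.χ y')) = -B₂.form y (B₂.χ (S y')) := by
    intro y y'
    rw [← h, χ_form', hT, χ_form', ← h]
    simp
  apply tensor_isAdjoint
  intro x y x' y'
  rw [TensorProduct.map_tmul, TensorProduct.map_tmul, tensorForm_tmul, tensorForm_tmul,
    twistedForm_apply, twistedForm_apply, Module.End.mul_apply, Module.End.mul_apply,
    B₁.rep_star a, B₁.χ_form, B₁.χ_rep, h]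
  cases B₁.formOdd
  · simp [χpow, paritySign]
  · cases B₂.formOdd <;> simp [χpow, paritySign, hS]

/-- The graded tensor product `B₁ ⊗̂ B₂` of two backgrounds, the second of which is
finite-dimensional. -/
def gradedTensor [StarModule ℝ A₁] [StarModule ℝ A₂] [FiniteDimensional ℂ K₂] :
    AlgebraicBackground (A₁ ⊗[ℝ] A₂) (K₁ ⊗[ℂ] K₂) where
  toKreinProduct := tensorKrein B₁ B₂
  rep := tensorRep B₁ B₂
  χ := TensorProduct.map B₁.χ B₂.χ
  J := tensorJ B₁ B₂
  Ω := tensorΩ B₁ B₂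
  formOdd := xor B₁.formOdd B₂.formOdd
  JOdd := xor B₁.JOdd B₂.JOdd
  rep_smul := tensorRep_smul B₁ B₂
  rep_star := tensorRep_star B₁ B₂
  χ_sq z := by
    induction z with
    | zero => simp
    | add z w hz hw => rw [map_add, map_add, hz, hw]
    | tmul x y => simp [B₁.χ_sq, B₂.χ_sq]
  χ_form := by
    refine tensor_ind₂ ?_ ?_ ?_ ?_ ?_
    · simp
    · simp
    · intro x y x' y'
      simp only [tensorKrein, TensorProduct.map_tmul, tensorForm_tmul, twistedForm_apply,
        B₁.χ_form, B₂.χ_form]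
      cases B₁.formOdd <;> cases B₂.formOdd <;> simp [paritySign, χpow] 
    · intro z z' w h h'
      simp [h, h', mul_add]
    · intro z w w' h h'
      simp [h, h', mul_add]
  χ_rep c := by
    induction c with
    | zero => simp
    | add c c' h h' => intro z; simp [h z, h' z]
    | tmul a b =>
      intro z
      rw [tensorRep_tmul]
      induction z with
      | zero => simp
      | add z w hz hw => simp only [map_add, hz, hw]
      | tmul x y => simp [B₁.χ_rep, B₂.χ_rep]
  J_sq := by
    have key : ∀ s₁ s₂ : ℂ, (∀ x, B₁.J (B₁.J x) = s₁ • x) → (∀ x, B₂.J (B₂.J x) = s₂ • x) →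
        ∀ z, tensorJ B₁ B₂ (tensorJ B₁ B₂ z) =
          (s₁ * s₂ * (if B₁.JOdd && B₂.JOdd then -1 else 1)) • z := by
      intro s₁ s₂ h₁ h₂ z
      induction z with
      | zero => simp
      | add z w hz hw => simp only [map_add, hz, hw, smul_add]
      | tmul x y =>
        rw [tensorJ_tmul, tensorJ_tmul, h₁]
        have := B₂.J_χ y
        have h3 : B₂.J (B₂.χpow B₁.JOdd (B₂.J (B₂.χpow B₁.JOdd y))) =
            (s₂ * (if B₁.JOdd && B₂.JOdd then -1 else 1)) • y := by
          cases B₁.JOdd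
          · simp [χpow, h₂]
          · simp only [χpow, if_true, B₂.J_χ, map_smulₛₗ, B₂.χ_sq, h₂]
            cases B₂.JOdd <;> simp [paritySign]
        rw [h3, TensorProduct.smul_tmul_smul, mul_assoc]
    have e₁ : ∃ s₁ : ℂ, (s₁ = 1 ∨ s₁ = -1) ∧ ∀ x, B₁.J (B₁.J x) = s₁ • x := by
      rcases B₁.J_sq with h | h
      · exact ⟨1, Or.inl rfl, by simpa using h⟩
      · exact ⟨-1, Or.inr rfl, by simpa using h⟩
    have e₂ : ∃ s₁ : ℂ, (s₁ = 1 ∨ s₁ = -1) ∧ ∀ x, B₂.J (B₂.J x) = s₁ • x := by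
      rcases B₂.J_sq with h | h
      · exact ⟨1, Or.inl rfl, by simpa using h⟩
      · exact ⟨-1, Or.inr rfl, by simpa using h⟩
    obtain ⟨s₁, hs₁, h₁⟩ := e₁
    obtain ⟨s₂, hs₂, h₂⟩ := e₂
    have := key s₁ s₂ h₁ h₂
    rcases hs₁ with rfl | rfl <;> rcases hs₂ with rfl | rfl <;>
      cases hb : (B₁.JOdd && B₂.JOdd) <;> simp [hb] at this <;> simp [this]
  J_χ z := by
    induction z with
    | zero => simp
    | add z w hz hw => simp only [map_add, hz, hw, smul_add]
    | tmul x y =>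
      rw [TensorProduct.map_tmul, tensorJ_tmul, tensorJ_tmul, B₁.J_χ, TensorProduct.map_tmul]
      have : B₂.J (B₂.χpow B₁.JOdd (B₂.χ y)) =
          paritySign B₂.JOdd • B₂.χ (B₂.J (B₂.χpow B₁.JOdd y)) := by
        cases B₁.JOdd <;> simp [χpow, B₂.J_χ]
      rw [this, TensorProduct.smul_tmul_smul]
      congr 1
      cases B₁.JOdd <;> cases B₂.JOdd <;> simp [paritySign]
  J_form := by
    have key : ∀ s₁ s₂ : ℂ, (∀ x y, B₁.form (B₁.J x) (B₁.J y) = s₁ * B₁.form y x) →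
        (∀ x y, B₂.form (B₂.J x) (B₂.J y) = s₂ * B₂.form y x) →
        ∀ z w, tensorForm B₁ B₂ (tensorJ B₁ B₂ z) (tensorJ B₁ B₂ w) =
          (s₁ * s₂ * (if B₁.formOdd && B₂.JOdd then -1 else 1) *
            (if B₁.formOdd && B₂.formOdd then -1 else 1) *
            (if B₁.JOdd && B₂.formOdd then -1 else 1)) * tensorForm B₁ B₂ w z := by
      intro s₁ s₂ h₁ h₂
      refine tensor_ind₂ ?_ ?_ ?_ ?_ ?_
      · simp
      · simp
      · intro x y x' y'
        have h2 : ∀ p v v', B₂.form (B₂.J v) (B₂.χpow p (B₂.J v')) =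
            s₂ * (if p && B₂.JOdd then -1 else 1) * (if p && B₂.formOdd then -1 else 1) *
              B₂.form v' (B₂.χpow p v) := by
          intro p v v'
          cases p
          · simp [χpow, h₂]
          · have e : B₂.χ (B₂.J v') = paritySign B₂.JOdd • B₂.J (B₂.χ v') := by
              rw [B₂.J_χ, smul_smul]
              cases B₂.JOdd <;> simp [paritySign]
            simp only [χpow, if_true, e, map_smul, h₂, B₂.χ_form]
            cases B₂.JOdd <;> cases B₂.formOdd <;> simp [paritySign]
        have h3 : ∀ p q, B₂.form (B₂.χpow q y') (B₂.χpow p (B₂.χpow q y)) =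
            (if q && B₂.formOdd then -1 else 1) * B₂.form y' (B₂.χpow p y) := by
          intro p q
          cases q
          · simp [χpow]
          · cases p <;> simp only [χpow, if_true, B₂.χ_form, B₂.χ_sq] <;>
              cases B₂.formOdd <;> simp [paritySign, B₂.χ_sq]
        rw [tensorJ_tmul, tensorJ_tmul, tensorForm_tmul, tensorForm_tmul, h₁,
          twistedForm_apply, twistedForm_apply, h2, h3]
        ring
      · intro z z' w h h'
        simp only [map_add, LinearMap.add_apply, h, h', mul_add]
      · intro z w w' h h'
        simp only [map_add, LinearMap.add_apply, h, h', mul_add]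
    have e₁ : ∃ s₁ : ℂ, (s₁ = 1 ∨ s₁ = -1) ∧
        ∀ x y, B₁.form (B₁.J x) (B₁.J y) = s₁ * B₁.form y x := by
      rcases B₁.J_form with h | h
      · exact ⟨1, Or.inl rfl, by simpa using h⟩
      · exact ⟨-1, Or.inr rfl, by simpa using h⟩
    have e₂ : ∃ s₁ : ℂ, (s₁ = 1 ∨ s₁ = -1) ∧
        ∀ x y, B₂.form (B₂.J x) (B₂.J y) = s₁ * B₂.form y x := by
      rcases B₂.J_form with h | h
      · exact ⟨1, Or.inl rfl, by simpa using h⟩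
      · exact ⟨-1, Or.inr rfl, by simpa using h⟩
    obtain ⟨s₁, hs₁, h₁⟩ := e₁
    obtain ⟨s₂, hs₂, h₂⟩ := e₂
    have := key s₁ s₂ h₁ h₂
    rcases hs₁ with rfl | rfl <;> rcases hs₂ with rfl | rfl <;>
      cases hb : (B₁.formOdd && B₂.JOdd) <;> cases hc : (B₁.JOdd && B₂.formOdd) <;>
      cases hd : (B₁.formOdd && B₂.formOdd) <;>
      simp [hb, hc, hd] at this <;> simp [tensorKrein, this]
  Ω_odd := by
    refine tensorΩ_induction B₁ B₂ ?_ ?_ (by simp) ?_ ?_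
    · intro ω hω a z
      induction z with
      | zero => simp
      | add z w hz hw => simp only [map_add, hz, hw, neg_add]
      | tmul x y => simp [B₁.Ω_odd ω hω, B₂.χ_rep, TensorProduct.neg_tmul]
    · intro a θ hθ z
      induction z with
      | zero => simp
      | add z w hz hw => simp only [map_add, hz, hw, neg_add]
      | tmul x y => simp [B₂.Ω_odd θ hθ, B₁.χ_rep, TensorProduct.tmul_neg]
    · intro T T' h h' z
      simp only [LinearMap.add_apply, map_add, h, h', neg_add]
    · intro T h z
      simp only [LinearMap.neg_apply, map_neg, h]
  Ω_left := tensorΩ_left B₁ B₂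
  Ω_right := tensorΩ_right B₁ B₂
  Ω_adj := by
    refine tensorΩ_induction B₁ B₂ ?_ ?_ ⟨0, fun z w => by simp⟩ ?_ ?_
    · intro ω hω a
      obtain ⟨S, hS⟩ := B₁.Ω_adj ω hω
      exact ⟨_, map_isAdjoint_even B₁ B₂ hS a⟩
    · intro a θ hθ
      obtain ⟨S, hS⟩ := B₂.Ω_adj θ hθ
      exact ⟨_, map_isAdjoint_odd B₁ B₂ hS (B₂.Ω_odd θ hθ) a⟩
    · rintro T T' ⟨S, h⟩ ⟨S', h'⟩
      exact ⟨S + S', fun z w => by simp [h z w, h' z w]⟩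
    · rintro T ⟨S, h⟩
      exact ⟨-S, fun z w => by simp [h z w]⟩
  order_zero c d := by
    have hop := tensorRep_star B₁ B₂
    apply LinearMap.ext fun z => ?_
    rw [Module.End.mul_apply, Module.End.mul_apply, KreinProduct.opp_apply_of _ (hop c),
      KreinProduct.opp_apply_of _ (hop c)]
    have key : ∀ a b a' b' x y, tensorJ B₁ B₂ (tensorRep B₁ B₂ (star (a ⊗ₜ b))
        ((tensorJ B₁ B₂).symm (tensorRep B₁ B₂ (a' ⊗ₜ b') (x ⊗ₜ y)))) =
        tensorRep B₁ B₂ (a' ⊗ₜ b') (tensorJ B₁ B₂ (tensorRep B₁ B₂ (star (a ⊗ₜ b))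
        ((tensorJ B₁ B₂).symm (x ⊗ₜ y)))) := by
      intro a b a' b' x y
      have hs : ∀ x y, (tensorJ B₁ B₂).symm (x ⊗ₜ y) =
          B₁.J.symm x ⊗ₜ B₂.χpow B₁.JOdd (B₂.J.symm y) := fun _ _ => rfl
      have hc : ∀ (b : A₂) y, B₂.χpow B₁.JOdd (B₂.rep b y) = B₂.rep b (B₂.χpow B₁.JOdd y) := by
        intro b y
        cases B₁.JOdd <;> simp [χpow, B₂.χ_rep]
      have z₁ := LinearMap.congr_fun (B₁.order_zero a a').eq x
      have z₂ := LinearMap.congr_fun (B₂.order_zero b b').eq y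
      simp only [Module.End.mul_apply] at z₁ z₂
      rw [B₁.opp_apply_of (B₁.rep_star a), B₁.opp_apply_of (B₁.rep_star a)] at z₁
      rw [B₂.opp_apply_of (B₂.rep_star b), B₂.opp_apply_of (B₂.rep_star b)] at z₂
      simp only [TensorProduct.star_tmul, tensorRep_tmul, TensorProduct.map_tmul, hs,
        tensorJ_tmul, hc, χpow_χpow, z₁, z₂]
    induction c with
    | zero => simp
    | add c c' h h' => simp only [star_add, map_add, LinearMap.add_apply, h, h']
    | tmul a b =>
      induction d with
      | zero => simp
      | add d d' h h' => simp only [map_add, LinearMap.add_apply, h, h']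
      | tmul a' b' =>
        induction z with
        | zero => simp
        | add z w hz hw => simp only [map_add, hz, hw]
        | tmul x y => exact key a b a' b' x y

/-- The operator `D₁ ⊗̂ 1 + 1 ⊗̂ D₂ = D₁ ⊗ 1 + χ₁ ⊗ D₂`, for an odd operator `D₂`. -/
def gradedSum (D₁ : Module.End ℂ K₁) (D₂ : Module.End ℂ K₂) : Module.End ℂ (K₁ ⊗[ℂ] K₂) :=
  TensorProduct.map D₁ 1 + TensorProduct.map B₁.χ D₂

end AlgebraicBackground

section Manifold

open scoped Manifold ContDiff
open Bundle (TotalSpace)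
open MeasureTheory

/-- The trivial involution on real smooth functions. -/
instance smoothFunctionStarRing {n : ℕ} {M : Type*} [TopologicalSpace M]
    [ChartedSpace (EuclideanSpace ℝ (Fin n)) M] : StarRing C^∞⟮𝓡 n, M; ℝ⟯ := starRingOfComm

instance smoothFunctionStarModule {n : ℕ} {M : Type*} [TopologicalSpace M]
    [ChartedSpace (EuclideanSpace ℝ (Fin n)) M] : StarModule ℝ C^∞⟮𝓡 n, M; ℝ⟯ :=
  ⟨fun _ _ => rfl⟩

/-- The cotangent space. -/
abbrev Cotangent {n : ℕ} {M : Type*} [TopologicalSpace M]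
    [ChartedSpace (EuclideanSpace ℝ (Fin n)) M] (x : M) : Type :=
  TangentSpace (𝓡 n) x →L[ℝ] Bundle.Trivial M ℝ x

/-- Smooth real 1-forms. -/
abbrev OneForm (n : ℕ) (M : Type*) [TopologicalSpace M]
    [ChartedSpace (EuclideanSpace ℝ (Fin n)) M] [IsManifold (𝓡 n) ∞ M] : Type _ :=
  Cₛ^∞⟮𝓡 n; EuclideanSpace ℝ (Fin n) →L[ℝ] ℝ,
    fun x : M => TangentSpace (𝓡 n) x →L[ℝ] Bundle.Trivial M ℝ x⟯

/-- Smoothness of a section of a vector bundle `S` with model fibre `F`. -/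
def IsSmoothSection (n : ℕ) {M : Type*} [TopologicalSpace M]
    [ChartedSpace (EuclideanSpace ℝ (Fin n)) M] (F : Type*) [NormedAddCommGroup F]
    [NormedSpace ℂ F] {S : M → Type*} [∀ x, TopologicalSpace (S x)]
    [TopologicalSpace (TotalSpace F S)] [FiberBundle F S] (ψ : ∀ x, S x) : Prop :=
  ContMDiff (𝓡 n) ((𝓡 n).prod 𝓘(ℝ, F)) ∞ fun x => TotalSpace.mk' F x (ψ x)

/-- The coordinate 1-form `dxⁱ` of a chart, at a point. -/
def coordForm {n : ℕ} {M : Type*} [TopologicalSpace M]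
    [ChartedSpace (EuclideanSpace ℝ (Fin n)) M]
    (e : OpenPartialHomeomorph M (EuclideanSpace ℝ (Fin n))) (x : M) (i : Fin n) :
    Cotangent (n := n) x :=
  (EuclideanSpace.proj i : EuclideanSpace ℝ (Fin n) →L[ℝ] ℝ).comp (mfderiv (𝓡 n) (𝓡 n) e x)

/-- A semi-Riemannian spin structure on a smooth manifold of even dimension `n`: a
semi-Riemannian metric `g` of arbitrary signature (given on covectors) with its volume measure,
and an irreducible Clifford module bundle `S` (the spinor bundle, a complex vector bundle of rank
`2^(n/2)`) with its spinor metric `H`, chirality `χ` and charge conjugation `J`.  The Clifford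
action is normalized as the commutator `c(df) = [D, f]` with the Dirac operator.
Smoothness of bundle maps is tested on smooth sections. -/
structure SpinStructure (n : ℕ) (M : Type*) [TopologicalSpace M]
    [ChartedSpace (EuclideanSpace ℝ (Fin n)) M] [IsManifold (𝓡 n) ∞ M] [MeasurableSpace M]
    (F : Type*) [NormedAddCommGroup F] [NormedSpace ℂ F] (S : M → Type*)
    [∀ x, AddCommGroup (S x)] [∀ x, Module ℂ (S x)] [∀ x, TopologicalSpace (S x)]
    [TopologicalSpace (TotalSpace F S)] [FiberBundle F S] [VectorBundle ℂ F S]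
    [VectorBundle ℝ F S] where
  even : Even n
  rank : Module.finrank ℂ F = 2 ^ (n / 2)
  /-- the metric, on covectors -/
  g : ∀ x : M, LinearMap.BilinForm ℝ (Cotangent (n := n) x)
  g_symm : ∀ x α β, g x α β = g x β α
  g_nondeg : ∀ x α, (∀ β, g x α β = 0) → α = 0
  g_smooth : ∀ α β : OneForm n M, ContMDiff (𝓡 n) 𝓘(ℝ, ℝ) ∞ fun x => g x (α x) (β x)
  /-- the volume measure -/
  vol : Measure M
  /-- in every chart the volume has density `|det g_{ij}|^{1/2} = |det g^{ij}|^{-1/2}` -/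
  vol_chart : ∀ e ∈ atlas (EuclideanSpace ℝ (Fin n)) M, ∀ s ⊆ e.source, MeasurableSet s →
    vol s = ∫⁻ y in e '' s, ENNReal.ofReal (1 / √|(Matrix.of fun i j : Fin n =>
      g (e.symm y) (coordForm e (e.symm y) i) (coordForm e (e.symm y) j)).det|)
  /-- (a consequence of the formula in charts) -/
  vol_compact : IsFiniteMeasureOnCompacts vol
  /-- (a consequence of the formula in charts) -/
  vol_open : vol.IsOpenPosMeasure
  /-- the Clifford action of covectors -/
  c : ∀ x : M, Cotangent (n := n) x →ₗ[ℝ] Module.End ℂ (S x)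
  c_sq : ∀ x α (s : S x), c x α (c x α s) = -((g x α α : ℝ) : ℂ) • s
  c_smooth : ∀ (α : OneForm n M) (ψ : ∀ x, S x), IsSmoothSection n F ψ →
    IsSmoothSection n F fun x => c x (α x) (ψ x)
  /-- the spinor metric -/
  H : ∀ x : M, S x →ₗ⋆[ℂ] S x →ₗ[ℂ] ℂ
  H_conj : ∀ x s t, conj (H x s t) = H x t s
  H_smooth : ∀ ψ φ : ∀ x, S x, IsSmoothSection n F ψ → IsSmoothSection n F φ →
    ContMDiff (𝓡 n) 𝓘(ℝ, ℂ) ∞ fun x => H x (ψ x) (φ x)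
  H_fundamentalSymmetry : ∃ η : ∀ x : M, Module.End ℂ (S x),
    (∀ ψ, IsSmoothSection n F ψ → IsSmoothSection n F fun x => η x (ψ x)) ∧
    (∀ x s, η x (η x s) = s) ∧ (∀ x s t, H x (η x s) t = H x s (η x t)) ∧
    ∀ x s, s ≠ 0 → 0 < (H x s (η x s)).re
  H_c : ∀ x α s t, H x (c x α s) t = -H x s (c x α t)
  /-- the chirality -/
  χ : ∀ x : M, Module.End ℂ (S x)
  χ_smooth : ∀ ψ, IsSmoothSection n F ψ → IsSmoothSection n F fun x => χ x (ψ x)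
  χ_sq : ∀ x s, χ x (χ x s) = s
  χ_c : ∀ x α s, χ x (c x α s) = -c x α (χ x s)
  /-- whether `χ` is anti-self-adjoint -/
  formOdd : Bool
  H_χ : ∀ x s t, H x (χ x s) t = paritySign formOdd * H x s (χ x t)
  /-- the charge conjugation -/
  J : ∀ x : M, S x ≃ₛₗ[starRingEnd ℂ] S x
  J_smooth : ∀ ψ, IsSmoothSection n F ψ → IsSmoothSection n F fun x => J x (ψ x)
  J_smooth' : ∀ ψ, IsSmoothSection n F ψ → IsSmoothSection n F fun x => (J x).symm (ψ x)
  J_sq : (∀ x s, J x (J x s) = s) ∨ (∀ x s, J x (J x s) = -s)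
  J_c : ∀ x α s, J x (c x α s) = c x α (J x s)
  /-- whether `J` anticommutes with `χ` -/
  JOdd : Bool
  J_χ : ∀ x s, J x (χ x s) = paritySign JOdd • χ x (J x s)
  H_J : (∀ x s t, H x (J x s) (J x t) = H x t s) ∨ (∀ x s t, H x (J x s) (J x t) = -H x t s)

section

variable {n : ℕ} {M : Type*} [TopologicalSpace M]
  [ChartedSpace (EuclideanSpace ℝ (Fin n)) M]
  {F : Type*} [NormedAddCommGroup F] [NormedSpace ℂ F] {S : M → Type*}
  [∀ x, AddCommGroup (S x)] [∀ x, Module ℂ (S x)] [∀ x, TopologicalSpace (S x)]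
  [TopologicalSpace (TotalSpace F S)] [FiberBundle F S] [VectorBundle ℂ F S]
  [VectorBundle ℝ F S]

set_option linter.unusedSectionVars false in
theorem IsSmoothSection.const_smul {ψ : ∀ x, S x} (h : IsSmoothSection n F ψ) (a : ℂ) :
    IsSmoothSection n F (a • ψ) := by
  intro x
  have hx := h x
  rw [Bundle.contMDiffAt_section] at hx ⊢
  have h1 : ContMDiffAt (𝓡 n) 𝓘(ℝ, F) ∞
      (fun y => a • (trivializationAt F S x ⟨y, ψ y⟩).2) x := by
    have : ContMDiff 𝓘(ℝ, F) 𝓘(ℝ, F) ∞ (fun v : F => a • v) :=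
      (contDiff_const_smul a).contMDiff
    exact this.contMDiffAt.comp x hx
  refine h1.congr_of_eventuallyEq ?_
  filter_upwards [(trivializationAt F S x).open_baseSet.mem_nhds
    (mem_baseSet_trivializationAt F S x)] with y hy
  exact ((trivializationAt F S x).linear ℂ hy).map_smul a (ψ y)

variable (n F S) in
/-- Compactly supported smooth sections of `S`. -/
def CompactSections : Submodule ℂ (∀ x, S x) where
  carrier := {ψ | IsSmoothSection n F ψ ∧ ∃ C : Set M, IsCompact C ∧ ∀ x ∉ C, ψ x = 0}
  zero_mem' := ⟨Bundle.contMDiff_zeroSection ℝ S, ∅, isCompact_empty, fun _ _ => rfl⟩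
  add_mem' := by
    rintro ψ φ ⟨h, C, hC, hψ⟩ ⟨h', C', hC', hφ⟩
    refine ⟨ContMDiff.add_section h h', C ∪ C', hC.union hC', fun x hx => ?_⟩
    rw [Set.mem_union, not_or] at hx
    simp [hψ x hx.1, hφ x hx.2]
  smul_mem' := by
    rintro a ψ ⟨h, C, hC, hψ⟩
    exact ⟨h.const_smul a, C, hC, fun x hx => by simp [hψ x hx]⟩

/-- A fibrewise complex-linear map preserving smoothness acts on compactly supported sections. -/
def fibrewise (T : ∀ x, Module.End ℂ (S x))
    (hT : ∀ ψ, IsSmoothSection n F ψ → IsSmoothSection n F fun x => T x (ψ x)) :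
    Module.End ℂ (CompactSections n F S) where
  toFun ψ := ⟨fun x => T x (ψ.1 x), hT _ ψ.2.1, by
    obtain ⟨C, hC, h⟩ := ψ.2.2
    exact ⟨C, hC, fun x hx => by simp [h x hx]⟩⟩
  map_add' ψ φ := by ext x; simp
  map_smul' a ψ := by ext x; simp

@[simp]
theorem fibrewise_apply (T : ∀ x, Module.End ℂ (S x))
    (hT : ∀ ψ, IsSmoothSection n F ψ → IsSmoothSection n F fun x => T x (ψ x))
    (ψ : CompactSections n F S) (x : M) : (fibrewise T hT ψ).1 x = T x (ψ.1 x) := rfl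

namespace SpinStructure

/-- Multiplication by a smooth function. -/
def mulOp (f : C^∞⟮𝓡 n, M; ℝ⟯) : Module.End ℂ (CompactSections n F S) :=
  fibrewise (fun x => ((f x : ℝ) : ℂ) • 1) fun ψ h => by
    have := ContMDiff.smul_section (V := S) f.contMDiff h
    simpa [IsSmoothSection] using this

theorem mulOp_apply (f : C^∞⟮𝓡 n, M; ℝ⟯) (ψ : CompactSections n F S) (x : M) :
    (mulOp f ψ).1 x = ((f x : ℝ) : ℂ) • ψ.1 x := rfl

variable (n M F S) in
/-- The representation of smooth functions by multiplication. -/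
def mulRep : C^∞⟮𝓡 n, M; ℝ⟯ →+* Module.End ℂ (CompactSections n F S) where
  toFun := mulOp
  map_one' := by ext ψ x; simp [mulOp]
  map_mul' f g := by ext ψ x; simp [mulOp, mul_smul]
  map_zero' := by ext ψ x; simp [mulOp]
  map_add' f g := by ext ψ x; simp [mulOp, add_smul]

theorem mulRep_apply (f : C^∞⟮𝓡 n, M; ℝ⟯) : mulRep n M F S f = mulOp f := rfl

end SpinStructure

end

namespace SpinStructure

variable {n : ℕ} {M : Type*} [TopologicalSpace M]
  [ChartedSpace (EuclideanSpace ℝ (Fin n)) M] [IsManifold (𝓡 n) ∞ M] [MeasurableSpace M]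
  {F : Type*} [NormedAddCommGroup F] [NormedSpace ℂ F] {S : M → Type*}
  [∀ x, AddCommGroup (S x)] [∀ x, Module ℂ (S x)] [∀ x, TopologicalSpace (S x)]
  [TopologicalSpace (TotalSpace F S)] [FiberBundle F S] [VectorBundle ℂ F S]
  [VectorBundle ℝ F S] (σ : SpinStructure n M F S)

theorem pairing_continuous (ψ φ : CompactSections n F S) :
    Continuous fun x => σ.H x (ψ.1 x) (φ.1 x) :=
  (σ.H_smooth _ _ ψ.2.1 φ.2.1).continuous

variable [T2Space M]

theorem pairing_compact (ψ φ : CompactSections n F S) :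
    HasCompactSupport fun x => σ.H x (ψ.1 x) (φ.1 x) := by
  obtain ⟨C, hC, h⟩ := ψ.2.2
  exact HasCompactSupport.intro hC fun x hx => by simp [h x hx]

variable [BorelSpace M]

theorem pairing_integrable (ψ φ : CompactSections n F S) :
    Integrable (fun x => σ.H x (ψ.1 x) (φ.1 x)) σ.vol :=
  have := σ.vol_compact
  (σ.pairing_continuous ψ φ).integrable_of_hasCompactSupport (σ.pairing_compact ψ φ)

/-- The Krein product `∫_M H(ψ, φ) vol_g`. -/
def krein : KreinProduct (CompactSections n F S) where
  form := LinearMap.mk₂'ₛₗ (starRingEnd ℂ) (RingHom.id ℂ)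
    (fun ψ φ => ∫ x, σ.H x (ψ.1 x) (φ.1 x) ∂σ.vol)
    (fun ψ ψ' φ => by
      rw [← integral_add (σ.pairing_integrable ψ φ) (σ.pairing_integrable ψ' φ)]
      simp)
    (fun a ψ φ => by
      rw [smul_eq_mul, ← integral_const_mul]
      simp)
    (fun ψ φ φ' => by
      rw [← integral_add (σ.pairing_integrable ψ φ) (σ.pairing_integrable ψ φ')]
      simp)
    (fun a ψ φ => by
      rw [RingHom.id_apply, smul_eq_mul, ← integral_const_mul]
      simp)
  conj_symm ψ φ := by
    simp only [LinearMap.mk₂'ₛₗ_apply, ← integral_conj, σ.H_conj]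
  exists_fundamentalSymmetry := by
    obtain ⟨η, h0, h1, h2, h3⟩ := σ.H_fundamentalSymmetry
    refine ⟨fibrewise η h0, fun ψ => ?_, fun ψ φ => ?_, fun ψ hψ => ?_⟩
    · ext x; simp [h1]
    · simp [LinearMap.mk₂'ₛₗ_apply, h2]
    · have := σ.vol_compact
      have := σ.vol_open
      rw [LinearMap.mk₂'ₛₗ_apply]
      have hint := σ.pairing_integrable ψ (fibrewise η h0 ψ)
      have hre := integral_re hint
      simp only [RCLike.re_to_complex] at hre
      rw [← hre]
      obtain ⟨x, hx⟩ : ∃ x, ψ.1 x ≠ 0 := by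
        by_contra hcon
        push Not at hcon
        exact hψ (Subtype.ext (funext hcon))
      refine Continuous.integral_pos_of_hasCompactSupport_nonneg_nonzero (x := x) ?_ ?_ ?_ ?_
      · exact Complex.continuous_re.comp (σ.pairing_continuous _ _)
      · exact (σ.pairing_compact ψ (fibrewise η h0 ψ)).comp_left Complex.zero_re
      · intro y
        by_cases hy : ψ.1 y = 0
        · simp [hy]
        · exact (h3 y _ hy).le
      · exact (h3 x _ hx).ne'

theorem krein_form (ψ φ : CompactSections n F S) :
    σ.krein.form ψ φ = ∫ x, σ.H x (ψ.1 x) (φ.1 x) ∂σ.vol := rfl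

theorem mulOp_isAdjoint (f : C^∞⟮𝓡 n, M; ℝ⟯) :
    σ.krein.IsAdjoint (mulOp f) (mulOp (star f)) := by
  intro ψ φ
  rw [krein_form, krein_form]
  congr 1
  ext x
  change σ.H x (((f x : ℝ) : ℂ) • ψ.1 x) (φ.1 x) = σ.H x (ψ.1 x) (((f x : ℝ) : ℂ) • φ.1 x)
  rw [map_smulₛₗ, map_smul, LinearMap.smul_apply, Complex.conj_ofReal]

/-- Clifford multiplication by a smooth 1-form. -/
def cliffordOp (α : OneForm n M) : Module.End ℂ (CompactSections n F S) :=
  fibrewise (fun x => σ.c x (α x)) (σ.c_smooth α)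

/-- Charge conjugation on spinor fields. -/
def conjOp : CompactSections n F S ≃ₛₗ[starRingEnd ℂ] CompactSections n F S where
  toFun ψ := ⟨fun x => σ.J x (ψ.1 x), σ.J_smooth _ ψ.2.1, by
    obtain ⟨C, hC, h⟩ := ψ.2.2
    exact ⟨C, hC, fun x hx => by simp [h x hx]⟩⟩
  invFun ψ := ⟨fun x => (σ.J x).symm (ψ.1 x), σ.J_smooth' _ ψ.2.1, by
    obtain ⟨C, hC, h⟩ := ψ.2.2
    exact ⟨C, hC, fun x hx => by simp [h x hx]⟩⟩
  map_add' ψ φ := by ext x; simp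
  map_smul' a ψ := by ext x; exact (σ.J x).map_smulₛₗ a _
  left_inv ψ := by ext x; simp
  right_inv ψ := by ext x; simp

/-- The canonical algebraic background over a spin manifold: real smooth functions acting by
multiplication on spinor fields, with Clifford multiplications by 1-forms as `Ω¹`. -/
def canonicalBackground :
    AlgebraicBackground C^∞⟮𝓡 n, M; ℝ⟯ (CompactSections n F S) where
  toKreinProduct := σ.krein
  rep := mulRep n M F S
  χ := fibrewise σ.χ σ.χ_smooth
  J := σ.conjOp
  Ω :=
    { carrier := Set.range σ.cliffordOp
      zero_mem' := ⟨0, by ext ψ x; simp [cliffordOp]⟩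
      add_mem' := by
        rintro _ _ ⟨α, rfl⟩ ⟨β, rfl⟩
        exact ⟨α + β, by ext ψ x; simp [cliffordOp]⟩
      neg_mem' := by
        rintro _ ⟨α, rfl⟩
        exact ⟨-α, by ext ψ x; simp [cliffordOp]⟩ }
  formOdd := σ.formOdd
  JOdd := σ.JOdd
  rep_smul r f := by ext ψ x; simp [mulRep_apply, mulOp, mul_smul]
  rep_star := σ.mulOp_isAdjoint
  χ_sq ψ := by ext x; simp [σ.χ_sq]
  χ_form ψ φ := by
    rw [krein_form, krein_form, ← integral_const_mul]
    simp [σ.H_χ]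
  χ_rep f ψ := by ext x; simp [mulOp, mulRep_apply]
  J_sq := by
    rcases σ.J_sq with h | h
    · left; intro ψ; ext x; simp [conjOp, h]
    · right; intro ψ; ext x; simp [conjOp, h]
  J_χ ψ := by ext x; simp [conjOp, σ.J_χ]
  J_form := by
    rcases σ.H_J with h | h
    · left; intro ψ φ; rw [krein_form, krein_form]; simp [conjOp, h]
    · right; intro ψ φ; rw [krein_form, krein_form, ← integral_neg]; simp [conjOp, h]
  Ω_odd := by
    rintro _ ⟨α, rfl⟩ ψ
    ext x; simp [cliffordOp, σ.χ_c]
  Ω_left := by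
    rintro f _ ⟨α, rfl⟩
    refine ⟨⟨fun x => f x • α x, ContMDiff.smul_section f.contMDiff α.contMDiff⟩, ?_⟩
    ext ψ x
    simp [cliffordOp, mulOp, mulRep_apply]
  Ω_right := by
    rintro f _ ⟨α, rfl⟩
    refine ⟨⟨fun x => f x • α x, ContMDiff.smul_section f.contMDiff α.contMDiff⟩, ?_⟩
    ext ψ x
    simp [cliffordOp, mulOp, mulRep_apply]
  Ω_adj := by
    rintro _ ⟨α, rfl⟩
    refine ⟨-σ.cliffordOp α, fun ψ φ => ?_⟩
    rw [krein_form, krein_form]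
    simp [cliffordOp, σ.H_c]
  order_zero f g := by
    apply LinearMap.ext fun ψ => ?_
    rw [mulRep_apply, mulRep_apply, Module.End.mul_apply, Module.End.mul_apply,
      KreinProduct.opp_apply_of _ (σ.mulOp_isAdjoint f),
      KreinProduct.opp_apply_of _ (σ.mulOp_isAdjoint f)]
    ext x
    change σ.J x (((f x : ℝ) : ℂ) • (σ.J x).symm (((g x : ℝ) : ℂ) • ψ.1 x)) =
      ((g x : ℝ) : ℂ) • σ.J x (((f x : ℝ) : ℂ) • (σ.J x).symm (ψ.1 x))
    simp only [map_smulₛₗ, map_mul, Complex.conj_ofReal, LinearEquiv.apply_symm_apply, smul_smul,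
      mul_comm]

end SpinStructure

end Manifold

end

/-!
Write `conjJ T = J T J⁻¹`, so that `Υ(u) = π(u) · conjJ π(u)`. For an arbitrary background, the
three conditions first take a form that involves 1-forms only. A gauge transformation always
preserves the Krein product, the algebra, `χ` and `J`, so weak C1 says that conjugation by
`conjJ π(u)` maps `Ω¹` into itself (`weakC1_iff`). A fluctuated Dirac operator is always
self-adjoint, odd and real, so weak C1' says that `[conjJ ω, π(a)] ∈ Ω¹` for every self-adjoint
1-form `ω` (`weakC1'_iff`). Weak C1'' follows from weak C1 by an averaging over `J`
(`WeakC1.weakC1''`). It thus remains to compare the first two conditions for the product and for its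
finite factor.

From the finite factor to the product, the part `Ω¹_M ⊗̂ A_F` of the 1-forms is harmless: `conjJ`
fixes real functions, and Clifford multiplications commute with functions, so this part commutes
with `conjJ` of the algebra. The part `A_M ⊗̂ Ω¹_F` consists of functions on `M` with values in
`Ω¹_F`. A unitary `U` of `C^∞(M) ⊗ A_F` takes unitary values, so the conjugate by `conjJ U` of such
a function again takes its values in `Ω¹_F` by weak C1 of the finite part, and a function in
`C^∞(M) ⊗ End(K_F)` with values in a subspace `W` lies in `C^∞(M) ⊗ W`
(`mem_range_of_evalTensor_mem`). For weak C1' one symmetrizes: for `T ∈ Ω¹`, the sum `T + T^×`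
is dealt with on generators, where `θ + θ^×` is a self-adjoint element of `Ω¹_F`; this uses that
`Ω¹_F` is stable under adjoints, a consequence of regularity
(`IsRegular.exists_adjoint_mem`).

From the product to the finite factor, one tests the conditions on constant functions and on the
1-forms `χ_M ⊗ θ`, and recovers `T ∈ Ω¹_F` from `χ_M ⊗ T ∈ Ω¹` (`mem_Ω_of_map_χ_mem`): averaging
over the conjugation by `χ_M ⊗ 1` removes the component in `Ω¹_M ⊗̂ A_F`, and pairing with a
section that does not vanish at a given point evaluates the remaining coefficients there.
-/

open scoped TensorProduct ComplexConjugate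

noncomputable section

/-! ### Krein adjoints -/

namespace KreinProduct

variable {K : Type*} [AddCommGroup K] [Module ℂ K] {κ : KreinProduct K}
  {T T' S S' : Module.End ℂ K}

theorem IsAdjoint.add (h : κ.IsAdjoint T S) (h' : κ.IsAdjoint T' S') :
    κ.IsAdjoint (T + T') (S + S') := fun x y => by simp [h x y, h' x y]

theorem IsAdjoint.neg (h : κ.IsAdjoint T S) : κ.IsAdjoint (-T) (-S) := fun x y => by simp [h x y]

theorem IsAdjoint.sub (h : κ.IsAdjoint T S) (h' : κ.IsAdjoint T' S') :
    κ.IsAdjoint (T - T') (S - S') := fun x y => by simp [h x y, h' x y]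

theorem IsAdjoint.mul (h : κ.IsAdjoint T S) (h' : κ.IsAdjoint T' S') :
    κ.IsAdjoint (T * T') (S' * S) := fun x y => by simp [h (T' x) y, h' x (S y)]

theorem IsAdjoint.real_smul (h : κ.IsAdjoint T S) (r : ℝ) :
    κ.IsAdjoint ((r : ℂ) • T) ((r : ℂ) • S) := fun x y => by
  rw [LinearMap.smul_apply, LinearMap.smul_apply, map_smulₛₗ, map_smul, LinearMap.smul_apply,
    Complex.conj_ofReal, h x y]

theorem IsAdjoint.symm (h : κ.IsAdjoint T S) : κ.IsAdjoint S T := fun x y => by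
  rw [← κ.conj_symm, ← h, κ.conj_symm]

theorem IsAdjoint.unique (h : κ.IsAdjoint T S) (h' : κ.IsAdjoint T S') : S = S' :=
  (κ.adj_eq h).symm.trans (κ.adj_eq h')

end KreinProduct

/-! ### Conjugation by the real structure and gauge transformations -/

namespace AlgebraicBackground

variable {A K : Type*} [Ring A] [StarRing A] [Algebra ℝ A]
  [AddCommGroup K] [Module ℂ K] (B : AlgebraicBackground A K)

/-- Conjugation `T ↦ J T J⁻¹` by the real structure. It agrees with `T ↦ T^o` on self-adjoint
operators and, unlike it, is multiplicative. -/
def conjJ : Module.End ℂ K ≃+* Module.End ℂ K := B.J.conjRingEquiv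

theorem conjJ_apply (T : Module.End ℂ K) (x : K) : B.conjJ T x = B.J (T (B.J.symm x)) := rfl

theorem conjJ_smul (r : ℝ) (T : Module.End ℂ K) :
    B.conjJ ((r : ℂ) • T) = (r : ℂ) • B.conjJ T := by
  ext x
  rw [conjJ_apply, LinearMap.smul_apply, map_smulₛₗ, Complex.conj_ofReal]
  rfl

theorem op_eq_conjJ {T S : Module.End ℂ K} (h : B.IsAdjoint T S) : B.op T = B.conjJ S :=
  LinearMap.ext (B.opp_apply_of h B.J)

theorem op_rep (a : A) : B.op (B.rep a) = B.conjJ (B.rep (star a)) := B.op_eq_conjJ (B.rep_star a)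

theorem conjJ_conjJ (T : Module.End ℂ K) : B.conjJ (B.conjJ T) = T := by
  ext x
  simp only [conjJ_apply]
  rcases B.J_sq with h | h
  · have hs : ∀ y, B.J.symm y = B.J y := fun y => by rw [LinearEquiv.symm_apply_eq, h]
    simp [hs, h]
  · have hs : ∀ y, B.J.symm y = -B.J y := fun y => by
      rw [LinearEquiv.symm_apply_eq, map_neg, h, neg_neg]
    simp [hs, h]

theorem isAdjoint_conjJ {T S : Module.End ℂ K} (h : B.IsAdjoint T S) :
    B.IsAdjoint (B.conjJ T) (B.conjJ S) := by
  intro x y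
  obtain ⟨x, rfl⟩ := B.J.surjective x
  obtain ⟨y, rfl⟩ := B.J.surjective y
  simp only [conjJ_apply, LinearEquiv.symm_apply_apply]
  rcases B.J_form with hJ | hJ <;> rw [hJ, hJ, h.symm]

theorem conjJ_eq_self_iff {T : Module.End ℂ K} : B.conjJ T = T ↔ ∀ x, T (B.J x) = B.J (T x) := by
  constructor
  · intro h x
    conv_lhs => rw [← h]
    simp [conjJ_apply]
  · intro h
    ext x
    rw [conjJ_apply, ← h, LinearEquiv.apply_symm_apply]

theorem conjJ_rep_commute (a b : A) : Commute (B.conjJ (B.rep a)) (B.rep b) := by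
  have := B.order_zero (star a) b
  change Commute (B.op (B.rep (star a))) (B.rep b) at this
  rwa [op_rep, star_star] at this

theorem conjJ_odd {T : Module.End ℂ K} (h : ∀ x, B.χ (T x) = -T (B.χ x)) (x : K) :
    B.χ (B.conjJ T x) = -B.conjJ T (B.χ x) := by
  obtain ⟨x, rfl⟩ := B.J.surjective x
  have h1 : ∀ y, B.χ (B.J y) = paritySign B.JOdd • B.J (B.χ y) := fun y => by
    rw [B.J_χ, smul_smul]
    cases B.JOdd <;> simp [paritySign]
  simp only [conjJ_apply, LinearEquiv.symm_apply_apply, h1, h, map_smulₛₗ, map_neg, smul_neg]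
  cases B.JOdd <;> simp [paritySign]

theorem rep_real_smul_one (r : ℝ) : B.rep (r • 1) = (r : ℂ) • 1 := by
  rw [B.rep_smul, map_one]

theorem real_smul_mem_Ω (r : ℝ) {ω : Module.End ℂ K} (h : ω ∈ B.Ω) : (r : ℂ) • ω ∈ B.Ω := by
  have := B.Ω_left (r • 1) ω h
  rwa [rep_real_smul_one, smul_one_mul] at this

theorem rep_mul_rep_star (u : unitary A) : B.rep (u : A) * B.rep (star (u : A)) = 1 := by
  rw [← map_mul]; simp

theorem rep_star_mul_rep (u : unitary A) : B.rep (star (u : A)) * B.rep (u : A) = 1 := by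
  rw [← map_mul]; simp

theorem conjJ_rep_mul_star (u : unitary A) :
    B.conjJ (B.rep (u : A)) * B.conjJ (B.rep (star (u : A))) = 1 := by
  rw [← map_mul, rep_mul_rep_star, map_one]

theorem gauge_val (u : unitary A) :
    (B.gauge u).val = B.rep (u : A) * B.conjJ (B.rep (u : A)) := by
  change B.rep u * B.op (B.rep (star u : A)) = _
  rw [op_rep, star_star]

theorem gauge_inv_val (u : unitary A) :
    (B.gauge u)⁻¹.val = B.conjJ (B.rep (star (u : A))) * B.rep (star (u : A)) := by
  change B.op (B.rep u) * B.rep (star u : A) = _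
  rw [op_rep]

theorem isAdjoint_gauge (u : unitary A) : B.IsAdjoint (B.gauge u).val (B.gauge u)⁻¹.val := by
  rw [gauge_val, gauge_inv_val]
  exact (B.rep_star _).mul (B.isAdjoint_conjJ (B.rep_star _))

theorem conjJ_gauge (u : unitary A) : B.conjJ (B.gauge u).val = (B.gauge u).val := by
  rw [gauge_val, map_mul, conjJ_conjJ]
  exact (B.conjJ_rep_commute _ _).eq

theorem conjJ_gauge_inv (u : unitary A) : B.conjJ (B.gauge u)⁻¹.val = (B.gauge u)⁻¹.val := by
  rw [gauge_inv_val, map_mul, conjJ_conjJ]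
  exact (B.conjJ_rep_commute _ _).eq.symm

theorem conjJ_rep_even (a : A) (x : K) :
    B.χ (B.conjJ (B.rep a) x) = B.conjJ (B.rep a) (B.χ x) := by
  obtain ⟨x, rfl⟩ := B.J.surjective x
  have h1 : ∀ y, B.χ (B.J y) = paritySign B.JOdd • B.J (B.χ y) := fun y => by
    rw [B.J_χ, smul_smul]
    cases B.JOdd <;> simp [paritySign]
  simp only [conjJ_apply, LinearEquiv.symm_apply_apply, h1, map_smulₛₗ, B.χ_rep]
  cases B.JOdd <;> simp [paritySign]

/-- Among the conditions on an automorphism, only the stability of the 1-forms is not automatic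
for gauge transformations; the factor `π(u)` of `Υ(u)` plays no role in it. -/
theorem weakC1_iff : B.WeakC1 ↔ ∀ u : unitary A, ∀ ω ∈ B.Ω,
    B.conjJ (B.rep (u : A)) * ω * B.conjJ (B.rep (star (u : A))) ∈ B.Ω := by
  constructor
  · intro h u ω hω
    have h1 : (B.gauge u).val * ω * (B.gauge u)⁻¹.val ∈ B.Ω := by
      have := Set.mem_image_of_mem (fun T => (B.gauge u).val * T * (B.gauge u)⁻¹.val) hω
      rwa [(h u).map_forms] at this
    have h2 := B.Ω_right (u : A) _ (B.Ω_left (star (u : A)) _ h1)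
    rw [gauge_val, gauge_inv_val] at h2
    convert h2 using 1
    calc _ = (B.rep (star (u : A)) * B.rep (u : A)) * (B.conjJ (B.rep (u : A)) * ω *
          B.conjJ (B.rep (star (u : A)))) * (B.rep (star (u : A)) * B.rep (u : A)) := by
          rw [rep_star_mul_rep, one_mul, mul_one]
      _ = _ := by simp only [mul_assoc]
  · intro h u
    have hmem : ∀ (u : unitary A), ∀ ω ∈ B.Ω, (B.gauge u).val * ω * (B.gauge u)⁻¹.val ∈ B.Ω := by
      intro u ω hω
      have := B.Ω_right (star (u : A)) _ (B.Ω_left (u : A) _ (h u ω hω))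
      rw [gauge_val, gauge_inv_val]
      simpa only [mul_assoc] using this
    have hrep : ∀ a, (B.gauge u).val * B.rep a * (B.gauge u)⁻¹.val =
        B.rep (u * a * star (u : A)) := by
      intro a
      rw [gauge_val, gauge_inv_val, map_mul, map_mul]
      calc _ = B.rep (u : A) * (B.conjJ (B.rep (u : A)) * B.rep a) *
            B.conjJ (B.rep (star (u : A))) * B.rep (star (u : A)) := by simp only [mul_assoc]
        _ = B.rep (u : A) * B.rep a * (B.conjJ (B.rep (u : A)) *
            B.conjJ (B.rep (star (u : A)))) * B.rep (star (u : A)) := by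
            rw [(B.conjJ_rep_commute _ _).eq]; simp only [mul_assoc]
        _ = _ := by rw [conjJ_rep_mul_star, mul_one]
    constructor
    · intro x y
      rw [B.isAdjoint_gauge u, ← Module.End.mul_apply]
      simp
    · ext T
      constructor
      · rintro ⟨_, ⟨a, rfl⟩, rfl⟩
        exact ⟨_, (hrep a).symm⟩
      · rintro ⟨a, rfl⟩
        refine ⟨_, ⟨star (u : A) * a * u, rfl⟩, ?_⟩
        dsimp only
        rw [hrep]
        congr 1
        calc _ = (u * star (u : A)) * a * (u * star (u : A)) := by simp only [mul_assoc]
          _ = a := by simp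
    · ext ω
      constructor
      · rintro ⟨ω, hω, rfl⟩
        exact hmem u ω hω
      · intro hω
        refine ⟨_, hmem (star u) ω hω, ?_⟩
        have e1 : (B.gauge (star u)).val = (B.gauge u)⁻¹.val := by
          rw [gauge_val, gauge_inv_val, Unitary.coe_star]
          exact (B.conjJ_rep_commute _ _).eq.symm
        have e2 : (B.gauge (star u))⁻¹.val = (B.gauge u).val := by
          rw [gauge_val, gauge_inv_val, Unitary.coe_star, star_star]
          exact (B.conjJ_rep_commute _ _).eq
        dsimp only
        rw [e1, e2]
        simp [mul_assoc]
    · exact B.conjJ_eq_self_iff.1 (B.conjJ_gauge u)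
    · intro x
      rw [gauge_val, Module.End.mul_apply, Module.End.mul_apply, B.χ_rep, conjJ_rep_even]

/-! ### Dirac operators and their fluctuations -/

section Dirac

variable {B} {D : Module.End ℂ K}

theorem IsDirac.conjJ_eq (hD : B.IsDirac D) : B.conjJ D = D := B.conjJ_eq_self_iff.2 hD.real

theorem IsCompatible.commutator_mem (hD : B.IsCompatible D) (a : A) :
    D * B.rep a - B.rep a * D ∈ B.Ω :=
  hD.2 (AddSubgroup.subset_closure ⟨1, a, by rw [map_one, one_mul]⟩)

/-- An operator all of whose commutators with the algebra are 1-forms satisfies `Ω¹_D ⊆ Ω¹`. -/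
theorem oneForms_le (h : ∀ a, D * B.rep a - B.rep a * D ∈ B.Ω) : B.oneForms D ≤ B.Ω := by
  rw [oneForms, AddSubgroup.closure_le]
  rintro _ ⟨a, b, rfl⟩
  exact B.Ω_left a _ (h b)

theorem IsRegular.isCompatible (hD : B.IsRegular D) : B.IsCompatible D := ⟨hD.1, hD.2.le⟩

/-- For a regular Dirac operator `(a [D, b])^× = b^* [D, a^*] - [D, b^* a^*]`, so the adjoint of a
1-form is a 1-form. -/
theorem IsRegular.exists_adjoint_mem (hD : B.IsRegular D) {ω : Module.End ℂ K} (hω : ω ∈ B.Ω) :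
    ∃ S ∈ B.Ω, B.IsAdjoint ω S := by
  rw [← hD.2] at hω
  induction hω using AddSubgroup.closure_induction with
  | mem T hT =>
    obtain ⟨a, b, rfl⟩ := hT
    have hc := hD.isCompatible.commutator_mem
    refine ⟨B.rep (star b) * (D * B.rep (star a) - B.rep (star a) * D) -
      (D * B.rep (star b * star a) - B.rep (star b * star a) * D),
      sub_mem (B.Ω_left _ _ (hc _)) (hc _), ?_⟩
    have hs : B.IsAdjoint D D := hD.1.selfAdj
    have := (B.rep_star a).mul ((hs.mul (B.rep_star b)).sub ((B.rep_star b).mul hs))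
    convert this using 1
    rw [map_mul]
    noncomm_ring
  | zero => exact ⟨0, zero_mem _, fun x y => by simp⟩
  | add T T' _ _ h h' =>
    obtain ⟨S, hS, h⟩ := h
    obtain ⟨S', hS', h'⟩ := h'
    exact ⟨S + S', add_mem hS hS', h.add h'⟩
  | neg T _ h =>
    obtain ⟨S, hS, h⟩ := h
    exact ⟨-S, neg_mem hS, h.neg⟩

theorem mem_fluctuatedDiracs {D' : Module.End ℂ K} : D' ∈ B.fluctuatedDiracs D ↔
    ∃ ω ∈ B.Ω, B.IsSelfAdj ω ∧ D' = D + ω + B.conjJ ω := by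
  refine exists_congr fun ω => and_congr_right fun _ => and_congr_right fun h => ?_
  rw [op_eq_conjJ B h]

/-- Fluctuations of a compatible Dirac operator always satisfy the conditions of `IsDirac`, so
weak C1' is a weak form of the first order condition, for self-adjoint 1-forms. -/
theorem weakC1'_iff (hD : B.IsCompatible D) : B.WeakC1' D ↔ ∀ ω ∈ B.Ω, B.IsSelfAdj ω →
    ∀ a, B.conjJ ω * B.rep a - B.rep a * B.conjJ ω ∈ B.Ω := by
  have key : ∀ (ω : Module.End ℂ K) (a : A), (D + ω + B.conjJ ω) * B.rep a -
      B.rep a * (D + ω + B.conjJ ω) = (D * B.rep a - B.rep a * D) + (ω * B.rep a - B.rep a * ω) +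
        (B.conjJ ω * B.rep a - B.rep a * B.conjJ ω) := by
    intro ω a
    noncomm_ring
  have hmem : ∀ ω ∈ B.Ω, ∀ a, (D * B.rep a - B.rep a * D) + (ω * B.rep a - B.rep a * ω) ∈ B.Ω :=
    fun ω hω a => add_mem (hD.commutator_mem a) (sub_mem (B.Ω_right a ω hω) (B.Ω_left a ω hω))
  constructor
  · intro h ω hω hs a
    have h1 : B.IsCompatible (D + ω + B.conjJ ω) := h (mem_fluctuatedDiracs.2 ⟨ω, hω, hs, rfl⟩)
    have h2 := h1.commutator_mem a
    rw [key] at h2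
    exact (AddSubgroup.add_mem_cancel_left _ (hmem ω hω a)).1 h2
  · intro h D' hD'
    obtain ⟨ω, hω, hs, rfl⟩ := mem_fluctuatedDiracs.1 hD'
    refine ⟨⟨?_, ?_, ?_⟩, oneForms_le fun a => ?_⟩
    · exact (KreinProduct.IsAdjoint.add hD.1.selfAdj hs).add (B.isAdjoint_conjJ hs)
    · intro x
      have h1 := B.Ω_odd ω hω
      simp only [LinearMap.add_apply, map_add, hD.1.odd, h1, B.conjJ_odd h1]
      abel
    · refine B.conjJ_eq_self_iff.1 ?_
      rw [map_add, map_add, conjJ_conjJ, hD.1.conjJ_eq]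
      abel
    · rw [key]
      exact add_mem (hmem ω hω a) (h ω hω hs a)

/-- Weak C1 implies weak C1''. With `v = J π(u) J⁻¹` and `ω₀ = π(u) D π(u)⁻¹ - D`, the operator
`Υ(u) D Υ(u)⁻¹ - D = v ω₀ v⁻¹ + J ω₀ J⁻¹` commutes with `J`, so it is half the sum of itself and of
its conjugate, which exhibits it as the fluctuation by the 1-form `(v ω₀ v⁻¹ + ω₀) / 2`. -/
theorem WeakC1.weakC1'' (h : B.WeakC1) (hD : B.IsCompatible D) : B.WeakC1'' D := by
  rintro u D' hD'
  obtain ⟨ω, hω, hs, rfl⟩ := mem_fluctuatedDiracs.1 hD'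
  have hv := B.weakC1_iff.1 h u
  have hG := B.conjJ_gauge u
  have hG' := B.conjJ_gauge_inv u
  have hGadj := B.isAdjoint_gauge u
  have hforms : ∀ ω ∈ B.Ω, (B.gauge u).val * ω * (B.gauge u)⁻¹.val ∈ B.Ω := fun ω hω => by
    have := Set.mem_image_of_mem (fun T => (B.gauge u).val * T * (B.gauge u)⁻¹.val) hω
    rwa [(h u).map_forms] at this
  have hDs : B.IsAdjoint D D := hD.1.selfAdj
  set ω₀ := B.rep (u : A) * D * B.rep (star (u : A)) - D with hω₀
  have hω₀mem : ω₀ ∈ B.Ω := by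
    have := B.Ω_left (u : A) _ (hD.commutator_mem (star (u : A)))
    rwa [mul_sub, ← mul_assoc, ← mul_assoc, rep_mul_rep_star, one_mul] at this
  have hu := B.rep_star (u : A)
  have hu' := B.rep_star (star (u : A))
  rw [star_star] at hu'
  have hω₀s : B.IsAdjoint ω₀ ω₀ := by
    have := ((hu.mul hDs).mul hu').sub hDs
    rwa [← mul_assoc] at this
  set v := B.conjJ (B.rep (u : A)) with hvdef
  set v' := B.conjJ (B.rep (star (u : A))) with hvdef'
  have hvv' : B.IsAdjoint v v' := B.isAdjoint_conjJ hu
  have hvv's : B.IsAdjoint v' v := hvv'.symm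
  set τ := v * ω₀ * v' with hτ
  have hτs : B.IsAdjoint τ τ := by
    have := (hvv'.mul hω₀s).mul hvv's
    rwa [← mul_assoc] at this
  have hE : (B.gauge u).val * D * (B.gauge u)⁻¹.val - D = τ + B.conjJ ω₀ := by
    have e1 : B.conjJ ω₀ = v * D * v' - D := by
      rw [hω₀, map_sub, map_mul, map_mul, hD.1.conjJ_eq]
    have e2 : (B.gauge u).val * D * (B.gauge u)⁻¹.val =
        v * (B.rep (u : A) * D * B.rep (star (u : A))) * v' := by
      have c1 := (B.conjJ_rep_commute (u : A) (u : A)).eq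
      have c2 := (B.conjJ_rep_commute (star (u : A)) (star (u : A))).eq
      rw [gauge_val, gauge_inv_val, ← c1, c2]
      simp only [mul_assoc, hvdef, hvdef']
    rw [e2, e1, hτ, hω₀]
    noncomm_ring
  have hEJ : B.conjJ τ + ω₀ = τ + B.conjJ ω₀ := by
    have := congrArg B.conjJ hE
    rwa [map_sub, map_mul, map_mul, hG, hG', hD.1.conjJ_eq, hE, map_add, conjJ_conjJ,
      eq_comm] at this
  refine mem_fluctuatedDiracs.2 ⟨(B.gauge u).val * ω * (B.gauge u)⁻¹.val +
    ((1 / 2 : ℝ) : ℂ) • (τ + ω₀), add_mem (hforms ω hω)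
      (B.real_smul_mem_Ω _ (add_mem (hv ω₀ hω₀mem) hω₀mem)), ?_, ?_⟩
  · refine KreinProduct.IsAdjoint.add ?_ ((hτs.add hω₀s).real_smul _)
    have := (hGadj.mul hs).mul hGadj.symm
    rwa [← mul_assoc] at this
  · have e : ((1 / 2 : ℝ) : ℂ) • (τ + ω₀) + B.conjJ (((1 / 2 : ℝ) : ℂ) • (τ + ω₀)) =
        τ + B.conjJ ω₀ := by
      rw [conjJ_smul, ← smul_add, map_add]
      have : τ + ω₀ + (B.conjJ τ + B.conjJ ω₀) = (2 : ℂ) • (τ + B.conjJ ω₀) := by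
        rw [two_smul]
        conv_rhs => arg 2; rw [← hEJ]
        abel
      rw [this, smul_smul]
      norm_num
    rw [map_add, map_mul, map_mul, hG, hG']
    have e' : D + ((B.gauge u).val * ω * (B.gauge u)⁻¹.val + ((1 / 2 : ℝ) : ℂ) • (τ + ω₀)) +
        ((B.gauge u).val * B.conjJ ω * (B.gauge u)⁻¹.val +
          B.conjJ (((1 / 2 : ℝ) : ℂ) • (τ + ω₀))) =
        (B.gauge u).val * ω * (B.gauge u)⁻¹.val + (B.gauge u).val * B.conjJ ω * (B.gauge u)⁻¹.val +
        D + (((1 / 2 : ℝ) : ℂ) • (τ + ω₀) + B.conjJ (((1 / 2 : ℝ) : ℂ) • (τ + ω₀))) := by abel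
    rw [e', e, ← hE]
    noncomm_ring

end Dirac

end AlgebraicBackground

/-! ### Vector-valued functions -/

section Evaluation

variable {A X V : Type*} [CommRing A] [Algebra ℝ A] [AddCommGroup V] [Module ℝ V]

/-- Evaluation of a `V`-valued function `t ∈ A ⊗ V` at a point `p`, a character of the algebra `A`
of real functions. -/
def evalTensor (V : Type*) [AddCommGroup V] [Module ℝ V] (p : A →ₐ[ℝ] ℝ) : A ⊗[ℝ] V →ₗ[ℝ] V :=
  TensorProduct.lid ℝ V ∘ₗ p.toLinearMap.rTensor V

@[simp]
theorem evalTensor_tmul (p : A →ₐ[ℝ] ℝ) (a : A) (v : V) :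
    evalTensor V p (a ⊗ₜ v) = p a • v := by
  simp [evalTensor]

theorem evalTensor_lTensor {W : Type*} [AddCommGroup W] [Module ℝ W] (p : A →ₐ[ℝ] ℝ)
    (g : V →ₗ[ℝ] W) (t : A ⊗[ℝ] V) : evalTensor W p (g.lTensor A t) = g (evalTensor V p t) := by
  induction t with
  | zero => simp
  | add t t' h h' => simp only [map_add, h, h']
  | tmul a v => simp

theorem evalTensor_mul {E : Type*} [Ring E] [Algebra ℝ E] (p : A →ₐ[ℝ] ℝ) (s t : A ⊗[ℝ] E) :
    evalTensor E p (s * t) = evalTensor E p s * evalTensor E p t := by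
  induction s with
  | zero => simp
  | add s s' h h' => simp only [map_add, add_mul, h, h']
  | tmul a v =>
    induction t with
    | zero => simp
    | add t t' h h' => simp only [map_add, mul_add, h, h']
    | tmul b w => simp [smul_smul, mul_comm]

theorem evalTensor_star {E : Type*} [Ring E] [StarRing E] [Algebra ℝ E] [StarModule ℝ E]
    [StarRing A] [StarModule ℝ A] {p : A →ₐ[ℝ] ℝ} (hp : ∀ a, p (star a) = p a) (t : A ⊗[ℝ] E) :
    evalTensor E p (star t) = star (evalTensor E p t) := by
  induction t with
  | zero => simp
  | add t t' h h' => simp only [map_add, star_add, h, h']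
  | tmul a v => simp [TensorProduct.star_tmul, hp]

/-- A vector-valued function vanishing at all points is zero. -/
theorem eq_zero_of_evalTensor {ev : X → A →ₐ[ℝ] ℝ} (hev : ∀ a, (∀ x, ev x a = 0) → a = 0)
    {t : A ⊗[ℝ] V} (h : ∀ x, evalTensor V (ev x) t = 0) : t = 0 := by
  classical
  let b := Module.Basis.ofVectorSpace ℝ V
  rw [← (TensorProduct.equivFinsuppOfBasisRight (M := A) b).map_eq_zero_iff]
  have key : ∀ x (t : A ⊗[ℝ] V) i,
      ev x (TensorProduct.equivFinsuppOfBasisRight b t i) = b.repr (evalTensor V (ev x) t) i := by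
    intro x t i
    induction t with
    | zero => simp
    | add t t' h h' => simp only [map_add, Finsupp.add_apply, h, h']
    | tmul a v =>
      simp [mul_comm]
  ext i
  exact hev _ fun x => by rw [key, h]; simp

/-- A function with values in a subspace `W` belongs to `A ⊗ W`. -/
theorem mem_range_of_evalTensor_mem {ev : X → A →ₐ[ℝ] ℝ}
    (hev : ∀ a, (∀ x, ev x a = 0) → a = 0) (W : Submodule ℝ V)
    {t : A ⊗[ℝ] V} (h : ∀ x, evalTensor V (ev x) t ∈ W) :
    t ∈ LinearMap.range (W.subtype.lTensor A) := by
  have hex : Function.Exact (W.subtype.lTensor A) (W.mkQ.lTensor A) :=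
    lTensor_exact A (LinearMap.exact_subtype_mkQ W) W.mkQ_surjective
  refine (hex t).1 (eq_zero_of_evalTensor hev fun x => ?_)
  rw [evalTensor_lTensor]
  exact (Submodule.Quotient.mk_eq_zero W).2 (h x)

end Evaluation

namespace AlgebraicBackground

/-- The properties of the canonical background of a manifold on which the reduction to the finite
part rests: `A` is an algebra of real functions on a set `X`, with evaluations `ev`, the
1-forms and the real structure commute with `A`, adjoints of 1-forms are 1-forms, and
some matrix coefficient of the representation is the evaluation at a point. -/
structure IsFunctionBackground {A K X : Type*} [CommRing A] [StarRing A] [Algebra ℝ A]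
    [AddCommGroup K] [Module ℂ K] (B : AlgebraicBackground A K) (ev : X → A →ₐ[ℝ] ℝ) :
    Prop where
  ev_star : ∀ x a, ev x (star a) = ev x a
  eq_zero_of_ev : ∀ a, (∀ x, ev x a = 0) → a = 0
  conjJ_rep : ∀ a, B.conjJ (B.rep a) = B.rep a
  Ω_commute : ∀ ω ∈ B.Ω, ∀ a, Commute ω (B.rep a)
  exists_adjoint_mem : ∀ ω ∈ B.Ω, ∃ S ∈ B.Ω, B.IsAdjoint ω S
  exists_coefficient : ∃ (x : X) (ψ : K) (l : K →ₗ[ℂ] ℂ), ∀ a, l (B.rep a ψ) = ev x a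

/-! ### Graded tensor products -/

section Tensor

variable {A₁ K₁ A₂ K₂ : Type*} [Ring A₁] [StarRing A₁] [Algebra ℝ A₁]
  [AddCommGroup K₁] [Module ℂ K₁] [Ring A₂] [StarRing A₂] [Algebra ℝ A₂]
  [AddCommGroup K₂] [Module ℂ K₂]
  (B₁ : AlgebraicBackground A₁ K₁) (B₂ : AlgebraicBackground A₂ K₂)

theorem tensorJ_symm_tmul (x : K₁) (y : K₂) : (tensorJ B₁ B₂).symm (x ⊗ₜ y) =
    B₁.J.symm x ⊗ₜ B₂.χpow B₁.JOdd (B₂.J.symm y) := rfl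

/-- Conjugation by `χ₁ ⊗ 1` changes the sign of `Ω¹₁ ⊗̂ A₂` and fixes `A₁ ⊗̂ Ω¹₂`. -/
theorem exists_decomposition_of_mem_tensorΩ {T : Module.End ℂ (K₁ ⊗[ℂ] K₂)}
    (hT : T ∈ tensorΩ B₁ B₂) :
    ∃ T' ∈ AddSubgroup.closure {T | ∃ a : A₁, ∃ θ ∈ B₂.Ω,
        T = TensorProduct.map (B₁.rep a * B₁.χ) θ},
      T + TensorProduct.map B₁.χ 1 * T * TensorProduct.map B₁.χ 1 = T' + T' := by
  refine tensorΩ_induction B₁ B₂ (P := fun T => ∃ T' ∈ AddSubgroup.closure {T | ∃ a : A₁,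
    ∃ θ ∈ B₂.Ω, T = TensorProduct.map (B₁.rep a * B₁.χ) θ},
      T + TensorProduct.map B₁.χ 1 * T * TensorProduct.map B₁.χ 1 = T' + T')
    ?_ ?_ ⟨0, zero_mem _, by simp⟩ ?_ ?_ T hT
  · intro ω hω a
    refine ⟨0, zero_mem _, TensorProduct.ext' fun x y => ?_⟩
    simp [B₁.Ω_odd ω hω, B₁.χ_sq, TensorProduct.neg_tmul]
  · intro a θ hθ
    refine ⟨_, AddSubgroup.subset_closure ⟨a, θ, hθ, rfl⟩, TensorProduct.ext' fun x y => ?_⟩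
    simp [B₁.χ_rep, B₁.χ_sq]
  · rintro T T' ⟨R, hR, h⟩ ⟨R', hR', h'⟩
    refine ⟨R + R', add_mem hR hR', ?_⟩
    rw [mul_add, add_mul, add_add_add_comm, h, h']
    abel
  · rintro T ⟨R, hR, h⟩
    refine ⟨-R, neg_mem hR, LinearMap.ext fun z => ?_⟩
    have hz := LinearMap.congr_fun h z
    simp only [LinearMap.add_apply, LinearMap.neg_apply, Module.End.mul_apply, map_neg] at hz ⊢
    rw [← neg_add, ← neg_add, hz]

variable [StarModule ℝ A₁] [StarModule ℝ A₂] [FiniteDimensional ℂ K₂]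

theorem conjJ_gradedTensor_map_rep (T : Module.End ℂ K₁) (a : A₂) :
    (B₁.gradedTensor B₂).conjJ (TensorProduct.map T (B₂.rep a)) =
      TensorProduct.map (B₁.conjJ T) (B₂.conjJ (B₂.rep a)) := by
  refine TensorProduct.ext' fun x y => ?_
  change tensorJ B₁ B₂ (TensorProduct.map T (B₂.rep a) ((tensorJ B₁ B₂).symm (x ⊗ₜ y))) = _
  have hc : ∀ y, B₂.χpow B₁.JOdd (B₂.rep a y) = B₂.rep a (B₂.χpow B₁.JOdd y) := by
    intro y
    cases B₁.JOdd <;> simp [χpow, B₂.χ_rep]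
  simp only [tensorJ_symm_tmul, TensorProduct.map_tmul, tensorJ_tmul, hc, χpow_χpow, conjJ_apply]

/-- The sign in `J₁ χ₁ = ± χ₁ J₁` cancels against that in `χ₂ᵖ θ χ₂ᵖ = ± θ`. -/
theorem conjJ_gradedTensor_map_odd (a : A₁) {θ : Module.End ℂ K₂}
    (hθ : ∀ x, B₂.χ (θ x) = -θ (B₂.χ x)) :
    (B₁.gradedTensor B₂).conjJ (TensorProduct.map (B₁.rep a * B₁.χ) θ) =
      TensorProduct.map (B₁.conjJ (B₁.rep a) * B₁.χ) (B₂.conjJ θ) := by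
  refine TensorProduct.ext' fun x y => ?_
  change tensorJ B₁ B₂ (TensorProduct.map (B₁.rep a * B₁.χ) θ
    ((tensorJ B₁ B₂).symm (x ⊗ₜ y))) = _
  obtain ⟨x, rfl⟩ := B₁.J.surjective x
  have h1 : B₁.χ (B₁.J x) = paritySign B₁.JOdd • B₁.J (B₁.χ x) := by
    rw [B₁.J_χ, smul_smul]
    cases B₁.JOdd <;> simp [paritySign]
  simp only [tensorJ_symm_tmul, TensorProduct.map_tmul, tensorJ_tmul, conjJ_apply,
    Module.End.mul_apply, LinearEquiv.symm_apply_apply, h1]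
  cases B₁.JOdd <;>
    simp [χpow, paritySign, hθ, B₂.χ_sq, TensorProduct.tmul_neg, TensorProduct.neg_tmul]

theorem gradedSum_isDirac {D₁ : Module.End ℂ K₁} {D₂ : Module.End ℂ K₂} (h₁ : B₁.IsDirac D₁)
    (h₂ : B₂.IsDirac D₂) : (B₁.gradedTensor B₂).IsDirac (B₁.gradedSum D₁ D₂) := by
  have hodd : ∀ x, B₂.χ (D₂ x) = -D₂ (B₂.χ x) := fun x => by rw [h₂.odd, neg_neg]
  have e1 : TensorProduct.map D₁ (1 : Module.End ℂ K₂) = TensorProduct.map D₁ (B₂.rep 1) := by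
    rw [map_one]
  have e2 : TensorProduct.map B₁.χ D₂ = TensorProduct.map (B₁.rep 1 * B₁.χ) D₂ := by
    rw [map_one, one_mul]
  constructor
  · have a1 := map_isAdjoint_even B₁ B₂ h₁.selfAdj (1 : A₂)
    have a2 := map_isAdjoint_odd B₁ B₂ h₂.selfAdj hodd (1 : A₁)
    rw [star_one, ← e1] at a1
    rw [star_one, ← e2] at a2
    exact a1.add a2
  · intro z
    change gradedSum B₁ D₁ D₂ (TensorProduct.map B₁.χ B₂.χ z) =
      -TensorProduct.map B₁.χ B₂.χ (gradedSum B₁ D₁ D₂ z)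
    induction z with
    | zero => simp
    | add z w hz hw => simp only [map_add, hz, hw, neg_add]
    | tmul x y =>
      simp only [gradedSum, LinearMap.add_apply, TensorProduct.map_tmul, map_add, h₁.odd, h₂.odd,
        Module.End.one_apply, TensorProduct.tmul_neg, TensorProduct.neg_tmul, neg_add]
  · refine (conjJ_eq_self_iff _).1 ?_
    rw [gradedSum, map_add, e2, conjJ_gradedTensor_map_odd B₁ B₂ 1 hodd, ← e2, e1,
      conjJ_gradedTensor_map_rep, h₁.conjJ_eq, h₂.conjJ_eq]
    simp

theorem gradedSum_isCompatible {D₁ : Module.End ℂ K₁} {D₂ : Module.End ℂ K₂}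
    (h₁ : B₁.IsCompatible D₁) (h₂ : B₂.IsCompatible D₂) :
    (B₁.gradedTensor B₂).IsCompatible (B₁.gradedSum D₁ D₂) := by
  refine ⟨gradedSum_isDirac B₁ B₂ h₁.1 h₂.1, oneForms_le fun c => ?_⟩
  change B₁.gradedSum D₁ D₂ * tensorRep B₁ B₂ c - tensorRep B₁ B₂ c * B₁.gradedSum D₁ D₂ ∈
    tensorΩ B₁ B₂
  induction c with
  | zero => simp
  | add c c' h h' =>
    have := add_mem h h'
    convert this using 1
    rw [map_add]
    noncomm_ring
  | tmul a b =>
    have := add_mem (map_mem_tensorΩ_left B₁ B₂ (h₁.commutator_mem a) b)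
      (map_mem_tensorΩ_right B₁ B₂ a (h₂.commutator_mem b))
    convert this using 1
    refine TensorProduct.ext' fun x y => ?_
    simp only [gradedSum, tensorRep_tmul, LinearMap.sub_apply, LinearMap.add_apply,
      Module.End.mul_apply, TensorProduct.map_tmul, Module.End.one_apply, map_add,
      TensorProduct.sub_tmul, TensorProduct.tmul_sub, B₁.χ_rep]
    abel

end Tensor

/-! ### Reduction of the weak conditions to the second factor -/

section FunctionBackground

variable {A₁ K₁ A₂ K₂ X : Type*} [CommRing A₁] [StarRing A₁] [Algebra ℝ A₁]
  [AddCommGroup K₁] [Module ℂ K₁] [Ring A₂] [StarRing A₂] [Algebra ℝ A₂]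
  [AddCommGroup K₂] [Module ℂ K₂]
  {B₁ : AlgebraicBackground A₁ K₁} (B₂ : AlgebraicBackground A₂ K₂) {ev : X → A₁ →ₐ[ℝ] ℝ}

/-- The 1-forms as a real subspace. -/
def realΩ {A K : Type*} [Ring A] [StarRing A] [Algebra ℝ A] [AddCommGroup K] [Module ℂ K]
    (B : AlgebraicBackground A K) : Submodule ℝ (Module.End ℂ K) where
  toAddSubmonoid := B.Ω.toAddSubmonoid
  smul_mem' r _ h := B.real_smul_mem_Ω r h

theorem mem_realΩ {A K : Type*} [Ring A] [StarRing A] [Algebra ℝ A] [AddCommGroup K] [Module ℂ K]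
    {B : AlgebraicBackground A K} {T : Module.End ℂ K} : T ∈ B.realΩ ↔ T ∈ B.Ω := Iff.rfl

/-- The action of `A₁ ⊗ End(K₂)`, the operator-valued functions, on `K₁ ⊗ K₂`. -/
def functionAction (B₁ : AlgebraicBackground A₁ K₁) (K₂ : Type*) [AddCommGroup K₂] [Module ℂ K₂] :
    A₁ ⊗[ℝ] Module.End ℂ K₂ →+* Module.End ℂ (K₁ ⊗[ℂ] K₂) :=
  letI : Module ℝ (K₁ ⊗[ℂ] K₂) := Module.complexToReal _
  (Algebra.TensorProduct.lift (R := ℝ) (S := ℝ) (C := Module.End ℂ (K₁ ⊗[ℂ] K₂))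
    (AlgHom.mk' ((Module.End.rTensorAlgHom ℂ K₁ K₂).toRingHom.comp B₁.rep) (by
      intro r a
      simp only [RingHom.comp_apply, B₁.rep_smul]
      exact map_smul (Module.End.rTensorAlgHom ℂ K₁ K₂) _ _))
    (AlgHom.mk' (Module.End.lTensorAlgHom ℂ K₂ K₁).toRingHom (fun r a =>
      map_smul (Module.End.lTensorAlgHom ℂ K₂ K₁) (r : ℂ) a))
    (fun a b => TensorProduct.ext' fun x y => rfl)).toRingHom

theorem functionAction_tmul (a : A₁) (T : Module.End ℂ K₂) :
    functionAction B₁ K₂ (a ⊗ₜ T) = TensorProduct.map (B₁.rep a) T :=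
  (Algebra.TensorProduct.lift_tmul _ _ _ _ _).trans (TensorProduct.ext' fun _ _ => rfl)

/-- The action `a ↦ J π(a) J⁻¹`, which commutes with `π` by the order zero condition, as a map of
real algebras. -/
def conjRep {A K : Type*} [Ring A] [StarRing A] [Algebra ℝ A] [AddCommGroup K] [Module ℂ K]
    (B : AlgebraicBackground A K) : A →ₐ[ℝ] Module.End ℂ K :=
  AlgHom.mk' ((B.conjJ : Module.End ℂ K →+* Module.End ℂ K).comp B.rep) fun r a => by
    change B.conjJ (B.rep (r • a)) = (r : ℂ) • B.conjJ (B.rep a)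
    rw [B.rep_smul, B.conjJ_smul]

theorem conjRep_apply {A K : Type*} [Ring A] [StarRing A] [Algebra ℝ A] [AddCommGroup K]
    [Module ℂ K] (B : AlgebraicBackground A K) (a : A) : B.conjRep a = B.conjJ (B.rep a) := rfl

theorem χ_functionAction_mem {t : A₁ ⊗[ℝ] Module.End ℂ K₂}
    (ht : t ∈ LinearMap.range (B₂.realΩ.subtype.lTensor A₁)) :
    TensorProduct.map B₁.χ 1 * functionAction B₁ K₂ t ∈ tensorΩ B₁ B₂ := by
  obtain ⟨s, rfl⟩ := ht
  induction s with
  | zero => simp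
  | add s s' h h' => simp only [map_add, mul_add]; exact add_mem h h'
  | tmul a θ =>
    rw [LinearMap.lTensor_tmul, functionAction_tmul, ← TensorProduct.map_mul, χ_mul_rep, one_mul]
    exact map_mem_tensorΩ_right B₁ B₂ a θ.2

theorem χ_functionAction_commute (t : A₁ ⊗[ℝ] Module.End ℂ K₂) :
    functionAction B₁ K₂ t * TensorProduct.map B₁.χ 1 =
      TensorProduct.map B₁.χ 1 * functionAction B₁ K₂ t := by
  induction t with
  | zero => simp
  | add t t' h h' => simp only [map_add, mul_add, add_mul, h, h']
  | tmul a T =>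
    rw [functionAction_tmul, ← TensorProduct.map_mul, ← TensorProduct.map_mul, χ_mul_rep, mul_one,
      one_mul]

/-- A 1-form `χ₁ ⊗ T` of the product comes from a 1-form `T` of the second factor: the component
in `Ω¹₁ ⊗̂ A₂` is killed by parity, and the other one is evaluated at a point. -/
theorem IsFunctionBackground.mem_Ω_of_map_χ_mem (h : B₁.IsFunctionBackground ev)
    {T : Module.End ℂ K₂} (hT : TensorProduct.map B₁.χ T ∈ tensorΩ B₁ B₂) : T ∈ B₂.Ω := by
  obtain ⟨T', hT', e⟩ := exists_decomposition_of_mem_tensorΩ B₁ B₂ hT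
  obtain ⟨x, ψ, l, hl⟩ := h.exists_coefficient
  -- the coefficient map, with `χ₁` undone on the vector `ψ`
  let c : Module.End ℂ (K₁ ⊗[ℂ] K₂) → K₂ → K₂ := fun R y =>
    TensorProduct.lid ℂ K₂ (l.rTensor K₂ (R (B₁.χ ψ ⊗ₜ y)))
  have hcadd : ∀ R R' y, c (R + R') y = c R y + c R' y := fun R R' y => by simp [c]
  have hc : ∀ R ∈ AddSubgroup.closure {T | ∃ a : A₁, ∃ θ ∈ B₂.Ω,
      T = TensorProduct.map (B₁.rep a * B₁.χ) θ}, ∃ θ ∈ B₂.Ω, ∀ y, c R y = θ y := by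
    intro R hR
    induction hR using AddSubgroup.closure_induction with
    | mem R hR =>
      obtain ⟨a, θ, hθ, rfl⟩ := hR
      exact ⟨_, B₂.real_smul_mem_Ω (ev x a) hθ, fun y => by simp [c, B₁.χ_sq, hl]⟩
    | zero => exact ⟨0, zero_mem _, fun y => by simp [c]⟩
    | add R R' _ _ h h' =>
      obtain ⟨θ, hθ, h⟩ := h
      obtain ⟨θ', hθ', h'⟩ := h'
      exact ⟨θ + θ', add_mem hθ hθ', fun y => by rw [hcadd, h, h']; rfl⟩
    | neg R _ h =>
      obtain ⟨θ, hθ, h⟩ := h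
      refine ⟨-θ, neg_mem hθ, fun y => ?_⟩
      rw [LinearMap.neg_apply, ← h]
      simp [c]
  have hone : l ψ = 1 := by
    have := hl 1
    rw [map_one, map_one] at this
    simpa using this
  obtain ⟨θ, hθ, hT'θ⟩ := hc T' hT'
  have : T = θ := by
    ext y
    have hy := congrArg (fun R => c R y) e
    simp only [hcadd, hT'θ] at hy
    have h2 : T y + T y = θ y + θ y := by
      rw [← hy]
      simp [c, B₁.χ_sq, hone]
    rw [← two_smul ℂ, ← two_smul ℂ] at h2
    exact smul_right_injective K₂ (two_ne_zero (α := ℂ)) h2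
  rwa [this]

variable [StarModule ℝ A₁] [StarModule ℝ A₂] [FiniteDimensional ℂ K₂]

theorem IsFunctionBackground.conjJ_tensorRep (h : B₁.IsFunctionBackground ev) (c : A₁ ⊗[ℝ] A₂) :
    (B₁.gradedTensor B₂).conjJ (tensorRep B₁ B₂ c) =
      functionAction B₁ K₂ (B₂.conjRep.toLinearMap.lTensor A₁ c) := by
  induction c with
  | zero => simp
  | add c c' h h' => simp only [map_add, h, h']
  | tmul a b =>
    rw [tensorRep_tmul, conjJ_gradedTensor_map_rep, h.conjJ_rep, LinearMap.lTensor_tmul,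
      functionAction_tmul, AlgHom.toLinearMap_apply, conjRep_apply]

theorem IsFunctionBackground.conjJ_tensorRep_commute (h : B₁.IsFunctionBackground ev)
    (c : A₁ ⊗[ℝ] A₂) {ω : Module.End ℂ K₁} (hω : ω ∈ B₁.Ω) (a : A₂) :
    Commute ((B₁.gradedTensor B₂).conjJ (tensorRep B₁ B₂ c)) (TensorProduct.map ω (B₂.rep a)) := by
  induction c with
  | zero => simp
  | add c c' h h' => simp only [map_add]; exact h.add_left h'
  | tmul f b =>
    rw [tensorRep_tmul, conjJ_gradedTensor_map_rep, h.conjJ_rep, commute_iff_eq,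
      ← TensorProduct.map_mul, ← TensorProduct.map_mul, (h.Ω_commute ω hω f).eq,
      (B₂.conjJ_rep_commute b a).eq]

theorem IsFunctionBackground.weakC1_gradedTensor_iff (h : B₁.IsFunctionBackground ev) :
    (B₁.gradedTensor B₂).WeakC1 ↔ B₂.WeakC1 := by
  rw [weakC1_iff, weakC1_iff]
  constructor
  · intro hC u θ hθ
    -- test weak C1 on the constant function `1 ⊗ u` and the 1-form `χ₁ ⊗ θ`
    let U : unitary (A₁ ⊗[ℝ] A₂) := ⟨1 ⊗ₜ (u : A₂), by
      rw [Unitary.mem_iff]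
      constructor <;> simp [TensorProduct.star_tmul, Algebra.TensorProduct.one_def]⟩
    have : _ ∈ tensorΩ B₁ B₂ := hC U (TensorProduct.map (B₁.rep 1 * B₁.χ) θ)
      (map_mem_tensorΩ_right B₁ B₂ 1 hθ)
    refine h.mem_Ω_of_map_χ_mem B₂ (T := _) ?_
    convert this using 1
    change _ = (B₁.gradedTensor B₂).conjJ (tensorRep B₁ B₂ (1 ⊗ₜ (u : A₂))) * _ *
      (B₁.gradedTensor B₂).conjJ (tensorRep B₁ B₂ (star (1 ⊗ₜ (u : A₂))))
    rw [TensorProduct.star_tmul, tensorRep_tmul, tensorRep_tmul, conjJ_gradedTensor_map_rep,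
      conjJ_gradedTensor_map_rep, ← TensorProduct.map_mul, ← TensorProduct.map_mul]
    simp
  · intro hC U T hT
    change (B₁.gradedTensor B₂).conjJ (tensorRep B₁ B₂ U) * T *
      (B₁.gradedTensor B₂).conjJ (tensorRep B₁ B₂ (star (U : A₁ ⊗[ℝ] A₂))) ∈ tensorΩ B₁ B₂
    revert T
    refine tensorΩ_induction B₁ B₂ ?_ ?_ (by simp) ?_ ?_
    · intro ω hω a
      rw [(h.conjJ_tensorRep_commute B₂ _ hω a).eq, mul_assoc]
      have := (B₁.gradedTensor B₂).conjJ_rep_mul_star U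
      change (B₁.gradedTensor B₂).conjJ (tensorRep B₁ B₂ U) *
        (B₁.gradedTensor B₂).conjJ (tensorRep B₁ B₂ (star (U : A₁ ⊗[ℝ] A₂))) = 1 at this
      rw [this, mul_one]
      exact map_mem_tensorΩ_left B₁ B₂ hω a
    · intro a θ hθ
      rw [h.conjJ_tensorRep, h.conjJ_tensorRep]
      set s := B₂.conjRep.toLinearMap.lTensor A₁ (U : A₁ ⊗[ℝ] A₂) with hs
      set s' := B₂.conjRep.toLinearMap.lTensor A₁ (star (U : A₁ ⊗[ℝ] A₂)) with hs'
      have e : TensorProduct.map (B₁.rep a * B₁.χ) θ =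
          TensorProduct.map B₁.χ 1 * functionAction B₁ K₂ (a ⊗ₜ θ) := by
        rw [functionAction_tmul, ← TensorProduct.map_mul, χ_mul_rep, one_mul]
      rw [e, ← mul_assoc, χ_functionAction_commute, mul_assoc, mul_assoc, ← map_mul, ← map_mul]
      refine χ_functionAction_mem B₂ (mem_range_of_evalTensor_mem h.eq_zero_of_ev _ fun x => ?_)
      -- at the point `x`, the unitary `U` takes a value `u` which is a unitary element of `A₂`
      have hstar := evalTensor_star (E := A₂) (h.ev_star x) (U : A₁ ⊗[ℝ] A₂)
      have hone : evalTensor A₂ (ev x) 1 = 1 := by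
        rw [Algebra.TensorProduct.one_def]
        simp
      let u : unitary A₂ := ⟨evalTensor A₂ (ev x) U, by
        rw [Unitary.mem_iff, ← hstar, ← evalTensor_mul, ← evalTensor_mul,
          Unitary.star_mul_self_of_mem U.2, Unitary.mul_star_self_of_mem U.2]
        exact ⟨hone, hone⟩⟩
      have := hC u _ (B₂.real_smul_mem_Ω (ev x a) hθ)
      rw [mem_realΩ, evalTensor_mul, evalTensor_mul, hs, hs', evalTensor_lTensor,
        evalTensor_lTensor, hstar, evalTensor_tmul, ← mul_assoc]
      exact this
    · intro T T' hT hT'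
      rw [mul_add, add_mul]
      exact add_mem hT hT'
    · intro T hT
      convert neg_mem hT using 1
      exact LinearMap.ext fun z => by simp

theorem IsFunctionBackground.weakC1'_gradedTensor_iff (h : B₁.IsFunctionBackground ev)
    {D₁ : Module.End ℂ K₁} {D₂ : Module.End ℂ K₂} (hD₁ : B₁.IsCompatible D₁)
    (hD₂ : B₂.IsRegular D₂) :
    (B₁.gradedTensor B₂).WeakC1' (B₁.gradedSum D₁ D₂) ↔ B₂.WeakC1' D₂ := by
  rw [weakC1'_iff (gradedSum_isCompatible B₁ B₂ hD₁ hD₂.isCompatible),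
    weakC1'_iff hD₂.isCompatible]
  have hodd := B₂.Ω_odd
  constructor
  · intro hC θ hθ hs b
    have h1 := map_isAdjoint_odd B₁ B₂ hs (hodd θ hθ) 1
    rw [star_one] at h1
    have : _ ∈ tensorΩ B₁ B₂ := hC _ (map_mem_tensorΩ_right B₁ B₂ 1 hθ) h1 (1 ⊗ₜ b)
    rw [conjJ_gradedTensor_map_odd B₁ B₂ 1 (hodd θ hθ)] at this
    refine h.mem_Ω_of_map_χ_mem B₂ ?_
    convert this using 1
    change _ = _ * tensorRep B₁ B₂ (1 ⊗ₜ b) - tensorRep B₁ B₂ (1 ⊗ₜ b) * _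
    rw [tensorRep_tmul, ← TensorProduct.map_mul, ← TensorProduct.map_mul]
    simp only [map_one, one_mul, mul_one]
    exact TensorProduct.ext' fun x y => by simp [TensorProduct.tmul_sub]
  · intro hC
    -- Symmetrizing each generator: it suffices to treat the sums of a 1-form and its adjoint.
    have key : ∀ T ∈ tensorΩ B₁ B₂, ∃ S, (tensorKrein B₁ B₂).IsAdjoint T S ∧
        ∀ c, (B₁.gradedTensor B₂).conjJ (T + S) * tensorRep B₁ B₂ c -
          tensorRep B₁ B₂ c * (B₁.gradedTensor B₂).conjJ (T + S) ∈ tensorΩ B₁ B₂ := by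
      refine tensorΩ_induction B₁ B₂ ?_ ?_ ⟨0, fun z w => by simp, fun c => by simp⟩ ?_ ?_
      · intro ω hω a
        obtain ⟨S, hS, hadj⟩ := h.exists_adjoint_mem ω hω
        refine ⟨_, map_isAdjoint_even B₁ B₂ hadj a, fun c => ?_⟩
        have hcomm : ∀ ω ∈ B₁.Ω, ∀ a : A₂,
            Commute ((B₁.gradedTensor B₂).conjJ (TensorProduct.map ω (B₂.rep a)))
              (tensorRep B₁ B₂ c) := by
          intro ω hω a
          have := (h.conjJ_tensorRep_commute B₂ c hω a).map (B₁.gradedTensor B₂).conjJ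
          rw [conjJ_conjJ] at this
          exact this.symm
        rw [map_add, ((hcomm ω hω a).add_left (hcomm S hS (star a))).eq, sub_self]
        exact zero_mem _
      · intro a θ hθ
        obtain ⟨S, hS, hadj⟩ := hD₂.exists_adjoint_mem hθ
        have hst : ∀ a : A₁, star a = a := fun a => by
          rw [← sub_eq_zero]
          exact h.eq_zero_of_ev _ fun x => by rw [map_sub, h.ev_star, sub_self]
        refine ⟨_, map_isAdjoint_odd B₁ B₂ hadj (hodd θ hθ) a, fun c => ?_⟩
        rw [hst, ← TensorProduct.map_add_right,
          conjJ_gradedTensor_map_odd B₁ B₂ a (hodd _ (add_mem hθ hS)), h.conjJ_rep]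
        have hsa : B₂.IsSelfAdj (θ + S) := by
          have := hadj.add hadj.symm
          rwa [add_comm S θ] at this
        induction c with
        | zero => simp
        | add c c' h h' =>
          have := add_mem h h'
          convert this using 1
          rw [map_add (tensorRep B₁ B₂), mul_add, add_mul, add_sub_add_comm]
        | tmul f b =>
          have := map_mem_tensorΩ_right B₁ B₂ (a * f) (hC _ (add_mem hθ hS) hsa b)
          convert this using 1
          refine TensorProduct.ext' fun x y => ?_
          have hf : ∀ z, B₁.rep f (B₁.rep a z) = B₁.rep a (B₁.rep f z) := fun z => by
            rw [← Module.End.mul_apply, ← Module.End.mul_apply, ← map_mul, ← map_mul, mul_comm]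
          simp only [tensorRep_tmul, LinearMap.sub_apply, Module.End.mul_apply, map_mul,
            TensorProduct.map_tmul, TensorProduct.tmul_sub, B₁.χ_rep, hf]
      · rintro T T' ⟨S, hS, h⟩ ⟨S', hS', h'⟩
        refine ⟨S + S', hS.add hS', fun c => ?_⟩
        have := add_mem (h c) (h' c)
        convert this using 1
        rw [add_add_add_comm, map_add, add_mul, mul_add, add_sub_add_comm]
      · rintro T ⟨S, hS, h⟩
        refine ⟨-S, hS.neg, fun c => ?_⟩
        have := neg_mem (h c)
        convert this using 1
        rw [← neg_add, map_neg]
        refine LinearMap.ext fun z => ?_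
        simp only [LinearMap.sub_apply, LinearMap.neg_apply, Module.End.mul_apply, map_neg]
        abel
    intro T hT hs c
    obtain ⟨S, hS, hc⟩ := key T hT
    obtain rfl : T = S := KreinProduct.IsAdjoint.unique hs hS
    have := (B₁.gradedTensor B₂).real_smul_mem_Ω (1 / 2) (hc c)
    convert this using 1
    change _ = ((1 / 2 : ℝ) : ℂ) • ((B₁.gradedTensor B₂).conjJ (T + T) *
      (B₁.gradedTensor B₂).rep c - (B₁.gradedTensor B₂).rep c * (B₁.gradedTensor B₂).conjJ (T + T))
    rw [map_add, add_mul, mul_add, add_sub_add_comm, ← two_smul ℂ, smul_smul]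
    norm_num

end FunctionBackground

end AlgebraicBackground

/-! ### The canonical background of a manifold -/

section Manifold

open scoped Manifold ContDiff
open Bundle (TotalSpace)
open MeasureTheory

variable {n : ℕ} {M : Type*} [TopologicalSpace M]
  [ChartedSpace (EuclideanSpace ℝ (Fin n)) M] [IsManifold (𝓡 n) ∞ M] [T2Space M]
  {F : Type*} [NormedAddCommGroup F] [NormedSpace ℂ F] {S : M → Type*}
  [∀ x, AddCommGroup (S x)] [∀ x, Module ℂ (S x)] [∀ x, TopologicalSpace (S x)]
  [TopologicalSpace (TotalSpace F S)] [FiberBundle F S] [VectorBundle ℂ F S]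
  [VectorBundle ℝ F S] [ContMDiffVectorBundle ∞ F S (𝓡 n)]

/-- Every vector of a fibre is the value of a compactly supported smooth section. -/
theorem CompactSections.exists_eq (x₀ : M) (v : S x₀) :
    ∃ ψ : CompactSections n F S, ψ.1 x₀ = v := by
  obtain ⟨s, hs, hsm⟩ := FiberBundle.exists_contMDiffOn_extend (k := ∞) (𝓡 n) F v
  obtain ⟨f, -, hf⟩ := (SmoothBumpFunction.nhds_basis_tsupport (I := 𝓡 n) x₀).mem_iff.1
    (interior_mem_nhds.2 hs)
  have hsm' : ContMDiff (𝓡 n) ((𝓡 n).prod 𝓘(ℝ, F)) ∞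
      fun x => TotalSpace.mk' F x ((f x : ℝ) • FiberBundle.extend F v x) :=
    ContMDiffOn.smul_section_of_tsupport (f.contMDiff.contMDiffOn) isOpen_interior
      hf (hsm.mono interior_subset)
  refine ⟨⟨fun x => (f x : ℝ) • FiberBundle.extend F v x, hsm', tsupport f, f.hasCompactSupport,
    fun x hx => ?_⟩, ?_⟩
  · simp [image_eq_zero_of_notMem_tsupport hx]
  · simp

namespace SpinStructure

variable [MeasurableSpace M] [BorelSpace M] (σ : SpinStructure n M F S)

/-- Evaluation of smooth functions at a point. -/
def evalAt (x : M) : C^∞⟮𝓡 n, M; ℝ⟯ →ₐ[ℝ] ℝ where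
  toFun f := f x
  map_one' := rfl
  map_mul' _ _ := rfl
  map_zero' := rfl
  map_add' _ _ := rfl
  commutes' _ := rfl

theorem canonicalBackground_isFunctionBackground [Nonempty M] :
    σ.canonicalBackground.IsFunctionBackground (evalAt (n := n) (M := M)) where
  ev_star _ _ := rfl
  eq_zero_of_ev _ h := ContMDiffMap.ext h
  conjJ_rep f := by
    refine LinearMap.ext fun ψ => Subtype.ext (funext fun x => ?_)
    change σ.J x (((f x : ℝ) : ℂ) • (σ.J x).symm (ψ.1 x)) = ((f x : ℝ) : ℂ) • ψ.1 x
    rw [map_smulₛₗ, Complex.conj_ofReal, LinearEquiv.apply_symm_apply]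
  Ω_commute := by
    rintro _ ⟨α, rfl⟩ f
    refine LinearMap.ext fun ψ => Subtype.ext (funext fun x => ?_)
    exact (σ.c x (α x)).map_smul _ _
  exists_adjoint_mem := by
    rintro _ ⟨α, rfl⟩
    refine ⟨-σ.cliffordOp α, neg_mem ⟨α, rfl⟩, fun ψ φ => ?_⟩
    change σ.krein.form _ _ = σ.krein.form _ _
    rw [krein_form, krein_form]
    simp [cliffordOp, σ.H_c]
  exists_coefficient := by
    obtain ⟨x₀⟩ := ‹Nonempty M›
    -- the rank `2 ^ (n / 2)` of the spinor bundle is positive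
    have hF : Nontrivial F := Module.nontrivial_of_finrank_pos (R := ℂ) (by rw [σ.rank]; positivity)
    have e : S x₀ ≃ₗ[ℂ] F := ((trivializationAt F S x₀).continuousLinearEquivAt ℂ x₀
      (FiberBundle.mem_baseSet_trivializationAt' x₀)).toLinearEquiv
    obtain ⟨w, hw⟩ := exists_ne (0 : F)
    obtain ⟨ψ, hψ⟩ := CompactSections.exists_eq (n := n) (F := F) x₀ (e.symm w)
    obtain ⟨l, hl⟩ := Module.Projective.exists_dual_ne_zero ℂ hw
    let ev : CompactSections n F S →ₗ[ℂ] S x₀ :=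
      (LinearMap.proj x₀) ∘ₗ (CompactSections n F S).subtype
    refine ⟨x₀, ψ, (l w)⁻¹ • (l ∘ₗ e.toLinearMap ∘ₗ ev), fun f => ?_⟩
    change (l w)⁻¹ * l (e (((f x₀ : ℝ) : ℂ) • ψ.1 x₀)) = ((f x₀ : ℝ) : ℂ)
    rw [hψ, map_smul, map_smul, LinearEquiv.apply_symm_apply, smul_eq_mul]
    field_simp

end SpinStructure

end Manifold

end

open scoped Manifold ContDiff TensorProduct

/-- An almost-commutative background satisfies weak C1, C1' and C1'' if and only if its finite
part does. -/
theorem mainTheorem4 {n : ℕ} {M : Type*} [TopologicalSpace M]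
    [ChartedSpace (EuclideanSpace ℝ (Fin n)) M] [IsManifold (𝓡 n) ∞ M] [T2Space M]
    [SecondCountableTopology M] [Nonempty M] [MeasurableSpace M] [BorelSpace M]
    {F : Type*} [NormedAddCommGroup F] [NormedSpace ℂ F] {S : M → Type*}
    [∀ x, AddCommGroup (S x)] [∀ x, Module ℂ (S x)] [∀ x, TopologicalSpace (S x)]
    [TopologicalSpace (Bundle.TotalSpace F S)] [FiberBundle F S] [VectorBundle ℂ F S]
    [VectorBundle ℝ F S] [ContMDiffVectorBundle ∞ F S (𝓡 n)]
    (σ : SpinStructure n M F S)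
    {A K : Type*} [Ring A] [StarRing A] [Algebra ℝ A] [StarModule ℝ A] [FiniteDimensional ℝ A]
    [AddCommGroup K] [Module ℂ K] [FiniteDimensional ℂ K]
    (BF : AlgebraicBackground A K)
    (DM : Module.End ℂ (CompactSections n F S)) (hDM : σ.canonicalBackground.IsRegular DM)
    (DF : Module.End ℂ K) (hDF : BF.IsRegular DF) :
    let B := σ.canonicalBackground.gradedTensor BF
    let D := σ.canonicalBackground.gradedSum DM DF
    (B.WeakC1 ∧ B.WeakC1' D ∧ B.WeakC1'' D) ↔
      (BF.WeakC1 ∧ BF.WeakC1' DF ∧ BF.WeakC1'' DF) := by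
  intro B D
  have h := σ.canonicalBackground_isFunctionBackground
  have h1 : B.WeakC1 ↔ BF.WeakC1 := h.weakC1_gradedTensor_iff BF
  have h2 : B.WeakC1' D ↔ BF.WeakC1' DF := h.weakC1'_gradedTensor_iff BF hDM.isCompatible hDF
  have hD : B.IsCompatible D :=
    AlgebraicBackground.gradedSum_isCompatible _ _ hDM.isCompatible hDF.isCompatible
  constructor
  · rintro ⟨hC, hC', -⟩
    exact ⟨h1.1 hC, h2.1 hC', (h1.1 hC).weakC1'' hDF.isCompatible⟩
  · rintro ⟨hC, hC', -⟩
    exact ⟨h1.2 hC, h2.2 hC', (h1.2 hC).weakC1'' hD⟩
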